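/- For a finite-dimensional complex Lie algebra $\mathfrak g$ and $f\in\mathfrak g^*$ put $\mathfrak g_f=\{x\in\mathfrak g : f([x,y])=0 \text{ for all } y\in\mathfrak g\}$. The index of $\mathfrak g$ is $\chi[\mathfrak g]=\min_{f\in\mathfrak g^*}\dim\mathfrak g_f$, and $\mathfrak g$ is called Frobenius if $\chi[\mathfrak g]=0$. For non-negative integers $a_1,\dots,a_k$ with sum $n\ge 1$, let $\mathfrak p(a_1,\dots,a_k)\subset\mathfrak{gl}(n,\mathbb C)$ be the parabolic subalgebra of block upper triangular matrices with successive diagonal blocks of sizes $a_1,\dots,a_k$ (blocks of size $0$ being omitted), and let $\mathfrak p_s(a_1,\dots,a_k)=\mathfrak p(a_1,\dots,a_k)\cap\mathfrak{sl}(n,\mathbb C)$. Let $a,b,c,\alpha$ be positive integers. 1) One has $$\chi[\mathfrak p(\alpha(a+b+c),a,b,c)]=\chi[\mathfrak p(a,\alpha|a-b-c|,b,c)]=\chi[\mathfrak p(a,b,\alpha|a+b-c|,c)]=\chi[\mathfrak p(a,b,c)].$$ 2) If $\gcd(a+b,b+c)=1$, then $\mathfrak p_s(a,b,c)$, $\mathfrak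 p_s(\alpha(a+b+c),a,b,c)$, $\mathfrak p_s(a,\alpha|a-b-c|,b,c)$, $\mathfrak p_s(a,b,\alpha|a+b-c|,c)$ and $\mathfrak p_s(a,b,c,\alpha(a+b+c))$ are Frobenius Lie algebras (each being a subalgebra of $\mathfrak{sl}(n,\mathbb C)$, where $n$ is the sum of its block sizes). -/

import Mathlib

attribute [local instance 100] LieRing.ofAssociativeRing

/-- The stabilizer `L_f = {x ∈ L | f ⁅x, y⁆ = 0 for all y ∈ L}` of a linear form `f` under the
coadjoint action, as a linear subspace of `L`. -/
def coadjointStabilizer {K L : Type*} [Field K] [LieRing L] [LieAlgebra K L]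
    (f : Module.Dual K L) : Submodule K L where
  carrier := {x | ∀ y : L, f ⁅x, y⁆ = 0}
  add_mem' := by
    intro x x' hx hx' y
    rw [add_lie, map_add, hx y, hx' y, add_zero]
  zero_mem' := by
    intro y
    rw [zero_lie, map_zero]
  smul_mem' := by
    intro t x hx y
    rw [smul_lie, map_smul, hx y, smul_zero]

/-- The index of a finite-dimensional Lie algebra: the minimal dimension of the stabilizer of a
linear form. The set is nonempty, so the infimum in `ℕ` is a minimum. -/
noncomputable def lieIndex (K L : Type*) [Field K] [LieRing L] [LieAlgebra K L]
    [FiniteDimensional K L] : ℕ :=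
  sInf {d : ℕ | ∃ f : Module.Dual K L, Module.finrank K (coadjointStabilizer f) = d}

/-- A finite-dimensional Lie algebra is Frobenius if its index is zero. -/
def IsFrobeniusLie (K L : Type*) [Field K] [LieRing L] [LieAlgebra K L]
    [FiniteDimensional K L] : Prop :=
  lieIndex K L = 0

/-- For a list `[a₁, …, aₖ]` cutting `0, 1, 2, …` into consecutive intervals of lengths
`a₁, …, aₖ`, the (zero-based) number of the interval which contains `i`. Intervals of length zero
contain no `i`, so zero entries of the list do not affect which `i` share an interval, nor the
order of the intervals. -/
def blockNumber : List ℕ → ℕ → ℕ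
  | [], _ => 0
  | a :: l, i => if i < a then 0 else blockNumber l (i - a) + 1

/-- The standard parabolic subalgebra `𝔭(a₁, …, aₖ)` of `𝔤𝔩(n, ℂ)`, `n = a₁ + ⋯ + aₖ`: the
block upper triangular matrices whose successive diagonal blocks have sizes `a₁, …, aₖ`. -/
def parabolic (a : List ℕ) : LieSubalgebra ℂ (Matrix (Fin a.sum) (Fin a.sum) ℂ) where
  carrier := {M | M.BlockTriangular (fun i : Fin a.sum => blockNumber a i)}
  add_mem' := fun hM hN => hM.add hN
  zero_mem' := Matrix.blockTriangular_zero
  smul_mem' := by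
    intro t M hM i j hij
    rw [Matrix.smul_apply, hM hij, smul_zero]
  lie_mem' := by
    intro M N hM hN
    exact (hM.mul hN).sub (hN.mul hM)

/-- `𝔭ₛ(a₁, …, aₖ) = 𝔭(a₁, …, aₖ) ∩ 𝔰𝔩(n, ℂ)`. -/
noncomputable def parabolicSL (a : List ℕ) :
    LieSubalgebra ℂ (Matrix (Fin a.sum) (Fin a.sum) ℂ) :=
  parabolic a ⊓ LieAlgebra.SpecialLinear.sl (Fin a.sum) ℂ

/-! The trace form identifies linear forms on `𝔭(a₁, …, aₖ)` with endomorphisms `F` of `V = ℂⁿ`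
modulo strictly block triangular ones. If `W` is the flag preserved by `𝔭`, the stabilizer of the
form consists of the `x` that preserve `W` and commute with the maps `W (j + 1) → V ⧸ W j` induced
by `F`. So the index is `flagIndex`, which depends only on the dimensions of the flag.

Key fact (`lieIndex_parabolic_add`): the index is unchanged when a block grows by the absolute
difference `d` of the sums of the blocks before and after it. By antitransposition the blocks before
may be assumed to have the larger sum. Then a generic `F` gives a surjection `W (i + 1) → V ⧸ W i`
with kernel of dimension `d`. The pullback of `V → V ⧸ W i` along it carries a flag whose `i`-th
block is larger by `d`, and stabilizers there inject into stabilizers on `V`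
(`exists_flag_of_pullback`). Conversely, dividing by the kernel shrinks the block by `d`, and `V` is
recovered as a pullback of the quotient, so stabilizers lift (`flagIndex_map_le`).

Inserting a block of size zero and enlarging it repeatedly gives part 1. For part 2, the same fact
runs a Euclidean algorithm on `(a + b, b + c)` down to `𝔤𝔩(1)`, of index 1. If `𝔭` has index 1, some
form has only the scalars as stabilizer, and its restriction to `𝔭ₛ` has stabilizer zero. -/

open Filter

/-! ### Generic members of a pencil of linear maps -/

section Generic

variable {K X Y : Type*} [Field K] [AddCommGroup X] [Module K X] [AddCommGroup Y] [Module K Y]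

theorem eventually_isUnit_add_smul_one [FiniteDimensional K X] (A : Module.End K X) :
    ∀ᶠ t : K in cofinite, IsUnit (A + t • (1 : Module.End K X)) := by
  have h : (spectrum K (-A)).Finite := Module.End.finite_spectrum _
  filter_upwards [h.compl_mem_cofinite] with t ht
  have h1 := spectrum.notMem_iff.1 ht
  rwa [sub_neg_eq_add, Algebra.algebraMap_eq_smul_one, add_comm] at h1

/-- A left inverse `g` of `B` turns `A + t • B` into `g ∘ A + t`, which is invertible for `t`
outside a finite spectrum. -/
theorem eventually_injective_add_smul [FiniteDimensional K X] (A B : X →ₗ[K] Y)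
    (hB : Function.Injective B) :
    ∀ᶠ t : K in cofinite, Function.Injective (A + t • B) := by
  obtain ⟨g, hg⟩ := B.exists_leftInverse_of_injective (LinearMap.ker_eq_bot.2 hB)
  filter_upwards [eventually_isUnit_add_smul_one (g ∘ₗ A)] with t ht
  have h1 : g ∘ₗ (A + t • B) = g ∘ₗ A + t • (1 : Module.End K X) := by
    rw [LinearMap.comp_add, LinearMap.comp_smul, hg]; rfl
  have h2 : Function.Injective (g ∘ₗ (A + t • B)) := by
    rw [h1]; exact ((Module.End.isUnit_iff _).1 ht).1
  exact Function.Injective.of_comp (f := g) (by simpa using h2)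

theorem eventually_surjective_add_smul [FiniteDimensional K Y] (A B : X →ₗ[K] Y)
    (hB : Function.Surjective B) : ∀ᶠ t : K in cofinite, Function.Surjective (A + t • B) := by
  obtain ⟨g, hg⟩ := B.exists_rightInverse_of_surjective (LinearMap.range_eq_top.2 hB)
  filter_upwards [eventually_isUnit_add_smul_one (A ∘ₗ g)] with t ht
  have h1 : (A + t • B) ∘ₗ g = A ∘ₗ g + t • (1 : Module.End K Y) := by
    rw [LinearMap.add_comp, LinearMap.smul_comp, hg]; rfl
  have h2 : Function.Surjective ((A + t • B) ∘ₗ g) := by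
    rw [h1]; exact ((Module.End.isUnit_iff _).1 ht).2
  exact Function.Surjective.of_comp (g := g) (by simpa using h2)

/-- `A` is injective on a complement `C` of its kernel. Hence so is `B + t⁻¹ • A` for almost all
`t`, and the kernel of `A + t • B` then meets `C` trivially. -/
theorem eventually_finrank_ker_add_smul_le [FiniteDimensional K X] (A B : X →ₗ[K] Y) :
    ∀ᶠ t : K in cofinite,
      Module.finrank K (LinearMap.ker (A + t • B)) ≤ Module.finrank K (LinearMap.ker A) := by
  obtain ⟨C, hC⟩ := Submodule.exists_isCompl (LinearMap.ker A)
  have hA : Function.Injective (A ∘ₗ C.subtype) := by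
    rw [← LinearMap.ker_eq_bot, LinearMap.ker_eq_bot']
    intro x hx
    have := Submodule.disjoint_def.1 hC.disjoint x hx x.2
    exact Subtype.ext this
  have h0 : ∀ᶠ t : K in cofinite, t ≠ 0 := by simp [Filter.eventually_cofinite]
  have h1 := (Function.Injective.tendsto_cofinite (inv_injective (G := K))).eventually
    (eventually_injective_add_smul (B ∘ₗ C.subtype) (A ∘ₗ C.subtype) hA)
  filter_upwards [h0, h1] with t ht hinj
  have hdis : Disjoint (LinearMap.ker (A + t • B)) C := by
    rw [Submodule.disjoint_def]
    intro x hx hxC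
    have hx' : A x + t • B x = 0 := by simpa using hx
    have : (⟨x, hxC⟩ : C) = 0 := by
      apply hinj
      have : t⁻¹ • (A x + t • B x) = 0 := by rw [hx', smul_zero]
      rw [smul_add, smul_smul, inv_mul_cancel₀ ht, one_smul, add_comm] at this
      simpa using this
    exact congrArg Subtype.val this
  have h2 := Submodule.finrank_add_finrank_le_of_disjoint hdis
  have h3 := Submodule.finrank_add_eq_of_isCompl hC
  omega

end Generic

/-! ### The index of a flag depends only on its dimensions -/

section Flag

variable {V U : Type*} [AddCommGroup V] [Module ℂ V] [AddCommGroup U] [Module ℂ U]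

/-- The endomorphisms `x` of `V` which preserve the filtration `W` and commute with all the maps
`W (j + 1) → V ⧸ W j` induced by `F`. -/
def flagStab (W : ℕ → Submodule ℂ V) (F : Module.End ℂ V) : Submodule ℂ (Module.End ℂ V) where
  carrier := {x | (∀ j, ∀ v ∈ W j, x v ∈ W j) ∧ ∀ j, ∀ v ∈ W (j + 1), x (F v) - F (x v) ∈ W j}
  add_mem' := by
    rintro x y ⟨h1, h2⟩ ⟨h3, h4⟩
    refine ⟨fun j v hv => (W j).add_mem (h1 j v hv) (h3 j v hv), fun j v hv => ?_⟩
    have := (W j).add_mem (h2 j v hv) (h4 j v hv)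
    simpa [add_sub_add_comm] using this
  zero_mem' := by simp
  smul_mem' := by
    rintro t x ⟨h1, h2⟩
    refine ⟨fun j v hv => (W j).smul_mem t (h1 j v hv), fun j v hv => ?_⟩
    have := (W j).smul_mem t (h2 j v hv)
    simpa [smul_sub] using this

/-- The minimal dimension of `flagStab W F`. -/
noncomputable def flagIndex (W : ℕ → Submodule ℂ V) : ℕ :=
  sInf {d : ℕ | ∃ F : Module.End ℂ V, Module.finrank ℂ (flagStab W F) = d}

theorem exists_finrank_flagStab_eq (W : ℕ → Submodule ℂ V) :
    ∃ F, Module.finrank ℂ (flagStab W F) = flagIndex W :=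
  Nat.sInf_mem (s := {d : ℕ | ∃ F : Module.End ℂ V, Module.finrank ℂ (flagStab W F) = d})
    ⟨_, 0, rfl⟩

theorem flagIndex_le (W : ℕ → Submodule ℂ V) (F : Module.End ℂ V) :
    flagIndex W ≤ Module.finrank ℂ (flagStab W F) :=
  Nat.sInf_le ⟨F, rfl⟩

theorem flagIndex_le_of_linearEquiv [FiniteDimensional ℂ V] (W : ℕ → Submodule ℂ V)
    (X : ℕ → Submodule ℂ U) (e : V ≃ₗ[ℂ] U) (he : ∀ j, (W j).map e.toLinearMap = X j) :
    flagIndex W ≤ flagIndex X := by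
  have hmem : ∀ j v, e v ∈ X j ↔ v ∈ W j := by
    intro j v
    rw [← he j]
    simp
  obtain ⟨G, hG⟩ := exists_finrank_flagStab_eq X
  rw [← hG]
  refine (flagIndex_le W (e.symm.conj G)).trans ?_
  have : FiniteDimensional ℂ U := e.finiteDimensional
  have hmaps : ∀ x ∈ flagStab W (e.symm.conj G), e.conj x ∈ flagStab X G := by
    rintro x ⟨h1, h2⟩
    refine ⟨fun j v hv => ?_, fun j v hv => ?_⟩
    · obtain ⟨v, rfl⟩ := e.surjective v
      rw [hmem] at hv
      simpa [LinearEquiv.conj_apply, hmem] using h1 j v hv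
    · obtain ⟨v, rfl⟩ := e.surjective v
      rw [hmem] at hv
      have := (hmem j _).2 (h2 j v hv)
      simpa [LinearEquiv.conj_apply] using this
  exact LinearMap.finrank_le_finrank_of_injective
    (f := (e.conj.toLinearMap).restrict hmaps)
    (fun x y hxy => Subtype.ext (e.conj.injective (congrArg Subtype.val hxy)))

/-- By modularity `B` is the direct sum of `A` and `C ⊓ B` for a complement `C` of `A`. So `g₀` on
`A` can be glued to any isomorphism of `C ⊓ B` with its counterpart in `U`. -/
theorem exists_extension_map_eq [FiniteDimensional ℂ V] [FiniteDimensional ℂ U]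
    {A B : Submodule ℂ V} {A' B' : Submodule ℂ U} (hAB : A ≤ B) (hAB' : A' ≤ B')
    (hA : Module.finrank ℂ A = Module.finrank ℂ A') (hB : Module.finrank ℂ B = Module.finrank ℂ B')
    (g₀ : V →ₗ[ℂ] U) (hg₀ : A.map g₀ = A') :
    ∃ g : V →ₗ[ℂ] U, (∀ v ∈ A, g v = g₀ v) ∧ B.map g = B' := by
  obtain ⟨C, hC⟩ := Submodule.exists_isCompl A
  obtain ⟨C', hC'⟩ := Submodule.exists_isCompl A'
  have e1 : A ⊔ C ⊓ B = B := by
    rw [← sup_inf_assoc_of_le C hAB, hC.sup_eq_top, top_inf_eq]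
  have e2 : A' ⊔ C' ⊓ B' = B' := by
    rw [← sup_inf_assoc_of_le C' hAB', hC'.sup_eq_top, top_inf_eq]
  have d1 := Submodule.finrank_sup_add_finrank_inf_eq A (C ⊓ B)
  have d2 := Submodule.finrank_sup_add_finrank_inf_eq A' (C' ⊓ B')
  rw [e1, ← inf_assoc, hC.inf_eq_bot, bot_inf_eq, finrank_bot] at d1
  rw [e2, ← inf_assoc, hC'.inf_eq_bot, bot_inf_eq, finrank_bot] at d2
  let h : ↥(C ⊓ B) ≃ₗ[ℂ] ↥(C' ⊓ B') := LinearEquiv.ofFinrankEq _ _ (by omega)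
  obtain ⟨k, hk⟩ := LinearMap.exists_extend ((C' ⊓ B').subtype ∘ₗ h.toLinearMap)
  have hgA : ∀ v ∈ A, LinearMap.ofIsCompl hC (g₀ ∘ₗ A.subtype) (k ∘ₗ C.subtype) v = g₀ v :=
    fun v hv => LinearMap.ofIsCompl_apply_left hC (φ := g₀ ∘ₗ A.subtype) (ψ := k ∘ₗ C.subtype) ⟨v, hv⟩
  refine ⟨LinearMap.ofIsCompl hC (g₀ ∘ₗ A.subtype) (k ∘ₗ C.subtype), hgA, ?_⟩
  have hgC : ∀ v ∈ C, LinearMap.ofIsCompl hC (g₀ ∘ₗ A.subtype) (k ∘ₗ C.subtype) v = k v :=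
    fun v hv => LinearMap.ofIsCompl_apply_right hC (φ := g₀ ∘ₗ A.subtype) (ψ := k ∘ₗ C.subtype) ⟨v, hv⟩
  have m1 : A.map (LinearMap.ofIsCompl hC (g₀ ∘ₗ A.subtype) (k ∘ₗ C.subtype)) = A' := by
    rw [← hg₀]
    exact SetLike.coe_injective (Set.image_congr hgA)
  have m2 : (C ⊓ B).map (LinearMap.ofIsCompl hC (g₀ ∘ₗ A.subtype) (k ∘ₗ C.subtype)) = C' ⊓ B' := by
    have : (C ⊓ B).map k = C' ⊓ B' := by
      rw [← LinearMap.range_domRestrict, LinearMap.domRestrict, hk, LinearMap.range_comp, LinearEquiv.range,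
        Submodule.map_subtype_top]
    rw [← this]
    exact SetLike.coe_injective (Set.image_congr fun v hv => hgC v hv.1)
  conv_lhs => rw [← e1]
  rw [Submodule.map_sup, m1, m2, e2]

theorem exists_map_flag_eq [FiniteDimensional ℂ V] [FiniteDimensional ℂ U]
    {W : ℕ → Submodule ℂ V} {X : ℕ → Submodule ℂ U} (hW : Monotone W) (hX : Monotone X)
    (hdim : ∀ j, Module.finrank ℂ (W j) = Module.finrank ℂ (X j)) (N : ℕ) :
    ∃ g : V →ₗ[ℂ] U, ∀ j ≤ N, (W j).map g = X j := by
  induction N with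
  | zero =>
    obtain ⟨g, -, hg⟩ := exists_extension_map_eq (bot_le : ⊥ ≤ W 0) (bot_le : ⊥ ≤ X 0)
      (by simp) (hdim 0) 0 (by simp)
    exact ⟨g, fun j hj => by rwa [Nat.le_zero.1 hj]⟩
  | succ N ih =>
    obtain ⟨g₀, hg₀⟩ := ih
    obtain ⟨g, h1, h2⟩ := exists_extension_map_eq (hW N.le_succ) (hX N.le_succ)
      (hdim N) (hdim (N + 1)) g₀ (hg₀ N le_rfl)
    refine ⟨g, fun j hj => ?_⟩
    rcases Nat.le_succ_iff.1 hj with hj | rfl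
    · rw [← hg₀ j hj]
      exact SetLike.coe_injective (Set.image_congr fun v hv => h1 v (hW hj hv))
    · exact h2

theorem flagIndex_le_of_finrank_eq [FiniteDimensional ℂ V] [FiniteDimensional ℂ U]
    {W : ℕ → Submodule ℂ V} {X : ℕ → Submodule ℂ U} (hW : Monotone W) (hX : Monotone X)
    (hdim : ∀ j, Module.finrank ℂ (W j) = Module.finrank ℂ (X j)) {N : ℕ}
    (hWN : W N = ⊤) (hXN : X N = ⊤) : flagIndex W ≤ flagIndex X := by
  obtain ⟨g, hg⟩ := exists_map_flag_eq hW hX hdim N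
  have hs : Function.Surjective g := by
    rw [← LinearMap.range_eq_top, ← Submodule.map_top, ← hWN, hg N le_rfl, hXN]
  have hVU : Module.finrank ℂ V = Module.finrank ℂ U := by
    have := hdim N
    rwa [hWN, hXN, finrank_top, finrank_top] at this
  have hi : Function.Injective g :=
    (LinearMap.injective_iff_surjective_of_finrank_eq_finrank hVU).2 hs
  refine flagIndex_le_of_linearEquiv W X (LinearEquiv.ofBijective g ⟨hi, hs⟩) fun j => ?_
  change (W j).map g = X j
  rcases le_total j N with h | h
  · exact hg j h
  · rw [top_le_iff.1 (hWN ▸ hW h : ⊤ ≤ W j), top_le_iff.1 (hXN ▸ hX h : ⊤ ≤ X j),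
      Submodule.map_top, LinearMap.range_eq_top.2 hs]

end Flag

/-! ### Generic endomorphisms, and enlarging a block by a pullback -/

section Reduction

theorem Submodule.finrank_le_of_mapsTo {K M N : Type*} [Field K] [AddCommGroup M] [Module K M]
    [AddCommGroup N] [Module K N] [FiniteDimensional K N] {A : Submodule K M} {B : Submodule K N}
    (T : M →ₗ[K] N) (hT : ∀ x ∈ A, T x ∈ B) (h0 : ∀ x ∈ A, T x = 0 → x = 0) :
    Module.finrank K A ≤ Module.finrank K B := by
  refine LinearMap.finrank_le_finrank_of_injective (f := T.restrict hT) ?_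
  refine (injective_iff_map_eq_zero _).2 fun x hx => ?_
  exact Subtype.ext (h0 x x.2 (congrArg Subtype.val hx))

variable {V : Type*} [AddCommGroup V] [Module ℂ V] [FiniteDimensional ℂ V]

/-- Among the generic `F` the stabilizer has minimal dimension. -/
theorem eventually_finrank_flagStab_le (W : ℕ → Submodule ℂ V) (F G : Module.End ℂ V) :
    ∀ᶠ t : ℂ in cofinite, Module.finrank ℂ (flagStab W (F + t • G)) ≤
      Module.finrank ℂ (flagStab W F) := by
  -- `D F` has kernel `flagStab W F` and is affine in `F`, with linear part `E` in the direction
  -- `G`. Its target may be infinite-dimensional, but semicontinuity only needs a finite-dimensional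
  -- source.
  let D : Module.End ℂ V → Module.End ℂ V →ₗ[ℂ]
      ((∀ j, W j →ₗ[ℂ] V ⧸ W j) × (∀ j, W (j + 1) →ₗ[ℂ] V ⧸ W j)) := fun F =>
    { toFun := fun x => (fun j => (W j).mkQ ∘ₗ x ∘ₗ (W j).subtype,
        fun j => (W j).mkQ ∘ₗ (x * F - F * x) ∘ₗ (W (j + 1)).subtype)
      map_add' := by
        intro x y
        ext j v
        · simp
        · simp [add_sub_add_comm]
      map_smul' := by
        intro t x
        ext j v
        · simp
        · simp [smul_sub] }
  have hker : ∀ F, LinearMap.ker (D F) = flagStab W F := by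
    intro F
    ext x
    rw [LinearMap.mem_ker]
    constructor
    · intro h
      have h1 := congrArg Prod.fst h
      have h2 := congrArg Prod.snd h
      refine ⟨fun j v hv => ?_, fun j v hv => ?_⟩
      · have := LinearMap.congr_fun (congrFun h1 j) ⟨v, hv⟩
        exact (Submodule.Quotient.mk_eq_zero _).1 this
      · have := LinearMap.congr_fun (congrFun h2 j) ⟨v, hv⟩
        exact (Submodule.Quotient.mk_eq_zero _).1 this
    · rintro ⟨h1, h2⟩
      refine Prod.ext (funext fun j => LinearMap.ext fun v => ?_)
        (funext fun j => LinearMap.ext fun v => ?_)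
      · exact (Submodule.Quotient.mk_eq_zero _).2 (h1 j v v.2)
      · exact (Submodule.Quotient.mk_eq_zero _).2 (h2 j v v.2)
  let E : Module.End ℂ V →ₗ[ℂ]
      ((∀ j, W j →ₗ[ℂ] V ⧸ W j) × (∀ j, W (j + 1) →ₗ[ℂ] V ⧸ W j)) :=
    { toFun := fun x => (0, fun j => (W j).mkQ ∘ₗ (x * G - G * x) ∘ₗ (W (j + 1)).subtype)
      map_add' := by
        intro x y
        ext j v
        · simp
        · simp [add_sub_add_comm]
      map_smul' := by
        intro t x
        ext j v
        · simp
        · simp [smul_sub] }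
  filter_upwards [eventually_finrank_ker_add_smul_le (D F) E] with t ht
  have hD : D (F + t • G) = D F + t • E := by
    refine LinearMap.ext fun x => Prod.ext ?_ (funext fun j => LinearMap.ext fun v => ?_)
    · simp [D, E]
    · change (W j).mkQ (x ((F + t • G) v) - (F + t • G) (x v)) =
        (W j).mkQ (x (F v) - F (x v)) + t • (W j).mkQ (x (G v) - G (x v))
      rw [← map_smul, ← map_add]
      congr 1
      simp only [LinearMap.add_apply, LinearMap.smul_apply, map_add, map_smul]
      module
  rwa [← hD, hker, hker] at ht

/-- On the line through a minimizer `F` in direction `G`, each requirement excludes finitely many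
`t`, so some `t` meets them all. Injectivity is conditional because only the quotient construction
needs it. -/
theorem exists_generic (W : ℕ → Submodule ℂ V) (i : ℕ) (G : Module.End ℂ V)
    (hs : ∀ v, ∃ w ∈ W (i + 1), v - G w ∈ W i) :
    ∃ F, Module.finrank ℂ (flagStab W F) = flagIndex W ∧
      (∀ v, ∃ w ∈ W (i + 1), v - F w ∈ W i) ∧
      ((∀ v ∈ W i, G v ∈ W i → v = 0) → ∀ v ∈ W i, F v ∈ W i → v = 0) := by
  obtain ⟨F, hF⟩ := exists_finrank_flagStab_eq W
  have h1 := eventually_finrank_flagStab_le W F G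
  have h2 : ∀ᶠ t : ℂ in cofinite, ∀ v, ∃ w ∈ W (i + 1), v - (F + t • G) w ∈ W i := by
    have := eventually_surjective_add_smul ((W i).mkQ ∘ₗ F ∘ₗ (W (i + 1)).subtype)
      ((W i).mkQ ∘ₗ G ∘ₗ (W (i + 1)).subtype) (by
        intro q
        obtain ⟨v, rfl⟩ := (W i).mkQ_surjective q
        obtain ⟨w, hw, h⟩ := hs v
        exact ⟨⟨w, hw⟩, ((Submodule.Quotient.eq _).2 h).symm⟩)
    filter_upwards [this] with t ht v
    obtain ⟨w, hw⟩ := ht ((W i).mkQ v)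
    exact ⟨w, w.2, (Submodule.Quotient.eq _).1 hw.symm⟩
  have h3 : ∀ᶠ t : ℂ in cofinite, (∀ v ∈ W i, G v ∈ W i → v = 0) →
      ∀ v ∈ W i, (F + t • G) v ∈ W i → v = 0 := by
    by_cases hG : ∀ v ∈ W i, G v ∈ W i → v = 0
    · have := eventually_injective_add_smul ((W i).mkQ ∘ₗ F ∘ₗ (W i).subtype)
        ((W i).mkQ ∘ₗ G ∘ₗ (W i).subtype) (by
          rw [← LinearMap.ker_eq_bot, LinearMap.ker_eq_bot']
          intro v hv
          exact Subtype.ext (hG v v.2 ((Submodule.Quotient.mk_eq_zero _).1 hv)))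
      filter_upwards [this] with t ht _ v hv h
      have : (⟨v, hv⟩ : W i) = 0 := by
        apply ht
        rw [map_zero]
        exact (Submodule.Quotient.mk_eq_zero _).2 h
      exact congrArg Subtype.val this
    · exact Eventually.of_forall fun t h => absurd h hG
  obtain ⟨t, h1, h2, h3⟩ := (h1.and (h2.and h3)).exists
  exact ⟨F + t • G, le_antisymm (hF ▸ h1) (flagIndex_le W _), h2, h3⟩

/-- The subspace of the `w ∈ W (i + 1)` which `F` maps to zero in `V ⧸ W i`. -/
def flagKer (W : ℕ → Submodule ℂ V) (F : Module.End ℂ V) (i : ℕ) : Submodule ℂ V :=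
  W (i + 1) ⊓ (W i).comap F

theorem finrank_flagKer {W : ℕ → Submodule ℂ V} {F : Module.End ℂ V} {i : ℕ}
    (hs : ∀ v, ∃ w ∈ W (i + 1), v - F w ∈ W i) :
    Module.finrank ℂ (flagKer W F i) + Module.finrank ℂ V =
      Module.finrank ℂ (W (i + 1)) + Module.finrank ℂ (W i) := by
  have h1 := LinearMap.finrank_range_add_finrank_ker ((W i).mkQ ∘ₗ F ∘ₗ (W (i + 1)).subtype)
  have h2 : LinearMap.range ((W i).mkQ ∘ₗ F ∘ₗ (W (i + 1)).subtype) = ⊤ := by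
    rw [LinearMap.range_eq_top]
    intro q
    obtain ⟨v, rfl⟩ := (W i).mkQ_surjective q
    obtain ⟨w, hw, h⟩ := hs v
    exact ⟨⟨w, hw⟩, ((Submodule.Quotient.eq _).2 h).symm⟩
  have h3 : LinearMap.ker ((W i).mkQ ∘ₗ F ∘ₗ (W (i + 1)).subtype) =
      (flagKer W F i).comap (W (i + 1)).subtype := by
    ext v
    simp [flagKer]
  rw [h2, h3, finrank_top] at h1
  have h4 := (Submodule.comapSubtypeEquivOfLe (inf_le_left : flagKer W F i ≤ W (i + 1))).finrank_eq
  have h5 := (W i).finrank_quotient_add_finrank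
  change Module.finrank ℂ ((flagKer W F i).comap (W (i + 1)).subtype) =
    Module.finrank ℂ (flagKer W F i) at h4
  omega

/-- If `F` induces a surjection `W (i + 1) → V ⧸ W i`, then the pullback `P` of `V → V ⧸ W i` along
this surjection, with projections `p` and `q`, carries a filtration with the same index or less, in
which the dimension of the `i`-th graded piece has grown. -/
theorem exists_flag_of_pullback {P : Type*} [AddCommGroup P] [Module ℂ P] [FiniteDimensional ℂ P]
    {W : ℕ → Submodule ℂ V} (hW : Monotone W) {F : Module.End ℂ V} {i : ℕ}
    (hs : ∀ v, ∃ w ∈ W (i + 1), v - F w ∈ W i) (p q : P →ₗ[ℂ] V)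
    (hext : ∀ z, p z = 0 → q z = 0 → z = 0)
    (hP : ∀ z, q z ∈ W (i + 1) ∧ p z - F (q z) ∈ W i)
    (hP' : ∀ u, ∀ w ∈ W (i + 1), u - F w ∈ W i → ∃ z, p z = u ∧ q z = w) :
    ∃ X : ℕ → Submodule ℂ P, Monotone X ∧
      (∀ j ≤ i, Module.finrank ℂ (X j) = Module.finrank ℂ (W j)) ∧
      (∀ j, i < j → Module.finrank ℂ (X j) =
        Module.finrank ℂ (W j) + Module.finrank ℂ (flagKer W F i)) ∧
      (∀ j, i < j → W j = ⊤ → X j = ⊤) ∧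
      flagIndex X ≤ Module.finrank ℂ (flagStab W F) := by
  have hext' : ∀ z z', p z = p z' → q z = q z' → z = z' := fun z z' h h' =>
    sub_eq_zero.1 (hext _ (by rw [map_sub, h, sub_self]) (by rw [map_sub, h', sub_self]))
  -- Up to level `i` this is the copy `(u, 0)` of `W j`; above `i` it is the full preimage of `W j`
  -- under `p`.
  let X : ℕ → Submodule ℂ P := fun j =>
    ((W j).comap p) ⊓ (if j ≤ i then LinearMap.ker q else ⊤)
  have hX : ∀ j (z : P), z ∈ X j ↔ p z ∈ W j ∧ (j ≤ i → q z = 0) := by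
    intro j z
    by_cases h : j ≤ i <;> simp [X, h]
  have hXmono : Monotone X := by
    intro j k hjk z hz
    rw [hX] at hz ⊢
    exact ⟨hW hjk hz.1, fun h => hz.2 (hjk.trans h)⟩
  -- a lift of `id : V → V` through `F`, modulo `W i`, which is the identity on `W (i + 1)`
  obtain ⟨π, hπ1, hπ2, hπ3⟩ : ∃ π : Module.End ℂ V, (∀ v, π v ∈ W (i + 1)) ∧
      (∀ v ∈ W (i + 1), π v = v) ∧ ∀ v, F v - F (π v) ∈ W i := by
    obtain ⟨C, hC⟩ := Submodule.exists_isCompl (W (i + 1))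
    have hsurj : Function.Surjective ((W i).mkQ ∘ₗ F ∘ₗ (W (i + 1)).subtype) := by
      intro q
      obtain ⟨v, rfl⟩ := (W i).mkQ_surjective q
      obtain ⟨w, hw, h⟩ := hs v
      exact ⟨⟨w, hw⟩, ((Submodule.Quotient.eq _).2 h).symm⟩
    obtain ⟨σ, hσ⟩ := LinearMap.exists_rightInverse_of_surjective _
      (LinearMap.range_eq_top.2 hsurj)
    let π : V →ₗ[ℂ] W (i + 1) :=
      LinearMap.ofIsCompl hC LinearMap.id (σ ∘ₗ (W i).mkQ ∘ₗ F ∘ₗ C.subtype)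
    have hl : ∀ v : W (i + 1), π v = v := fun v => LinearMap.ofIsCompl_apply_left hC v
    have hr : ∀ v : C, π v = σ ((W i).mkQ (F v)) := fun v => LinearMap.ofIsCompl_apply_right hC v
    refine ⟨(W (i + 1)).subtype ∘ₗ π, fun v => (π v).2, fun v hv => ?_, fun v => ?_⟩
    · exact congrArg Subtype.val (hl ⟨v, hv⟩)
    · obtain ⟨u, hu, c, hc, rfl⟩ := Submodule.mem_sup.1
        (hC.sup_eq_top ▸ Submodule.mem_top : v ∈ W (i + 1) ⊔ C)
      have e1 : π u = ⟨u, hu⟩ := hl ⟨u, hu⟩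
      have e2 : π c = σ ((W i).mkQ (F c)) := hr ⟨c, hc⟩
      have e3 : (W i).mkQ (F (π c)) = (W i).mkQ (F c) := by
        rw [e2]
        exact LinearMap.congr_fun hσ _
      have e4 : F c - F (π c) ∈ W i := (Submodule.Quotient.eq _).1 e3.symm
      simpa [e1] using e4
  obtain ⟨e, he⟩ : ∃ e : P →ₗ[ℂ] V × V, e = p.prod q := ⟨_, rfl⟩
  have heinj : Function.Injective e := by
    intro z z' h
    rw [he] at h
    exact hext' z z' (congrArg Prod.fst h) (congrArg Prod.snd h)
  obtain ⟨r, hr⟩ := e.exists_leftInverse_of_injective (LinearMap.ker_eq_bot.2 heinj)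
  -- `(F u, π u)` lies in the pullback by the choice of `π`. This lifts `F` and vanishes on the
  -- kernel of `p`.
  obtain ⟨Φ, hΦ1, hΦ2⟩ : ∃ Φ : Module.End ℂ P,
      (∀ z, p (Φ z) = F (p z)) ∧ ∀ z, q (Φ z) = π (p z) := by
    have h : ∀ z, e (r (F (p z), π (p z))) = (F (p z), π (p z)) := by
      intro z
      obtain ⟨y, hy1, hy2⟩ := hP' (F (p z)) (π (p z)) (hπ1 _) (hπ3 _)
      have hy : e y = (F (p z), π (p z)) := by rw [he, ← hy1, ← hy2]; rfl
      rw [← hy]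
      exact congrArg e (LinearMap.congr_fun hr y)
    refine ⟨r ∘ₗ (F.prod π) ∘ₗ p, fun z => ?_, fun z => ?_⟩
    · have := congrArg Prod.fst (h z)
      rwa [he] at this
    · have := congrArg Prod.snd (h z)
      rwa [he] at this
  have hfst : Function.Surjective p := by
    intro u
    obtain ⟨w, hw, h⟩ := hs u
    obtain ⟨z, hz, -⟩ := hP' u w hw h
    exact ⟨z, hz⟩
  have hlift : ∀ j, ∀ u ∈ W j, ∃ z : P, z ∈ X j ∧ p z = u := by
    intro j u hu
    by_cases h : j ≤ i
    · obtain ⟨z, hz1, hz2⟩ := hP' u 0 (zero_mem _) (by simpa using hW h hu)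
      refine ⟨z, ?_, hz1⟩
      rw [hX, hz1]
      exact ⟨hu, fun _ => hz2⟩
    · obtain ⟨z, rfl⟩ := hfst u
      refine ⟨z, ?_, rfl⟩
      rw [hX]
      exact ⟨hu, fun h' => absurd h' h⟩
  have hrange : ∀ j, (X j).map p = W j := by
    intro j
    ext u
    constructor
    · rintro ⟨z, hz, rfl⟩
      exact ((hX j z).1 hz).1
    · intro hu
      obtain ⟨z, hz, rfl⟩ := hlift j u hu
      exact ⟨z, hz, rfl⟩
  have hdim : ∀ j, Module.finrank ℂ (X j) = Module.finrank ℂ (W j) + Module.finrank ℂ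
      (LinearMap.ker (p.domRestrict (X j))) := by
    intro j
    have := LinearMap.finrank_range_add_finrank_ker (p.domRestrict (X j))
    rw [LinearMap.range_domRestrict, hrange] at this
    exact this.symm
  refine ⟨X, hXmono, fun j hj => ?_, fun j hj => ?_, fun j hj hj' => ?_, ?_⟩
  · rw [hdim j]
    convert Nat.add_zero _
    rw [LinearMap.ker_eq_bot'.2, finrank_bot]
    intro z hz
    exact Subtype.ext (hext _ hz (((hX j _).1 z.2).2 hj))
  · rw [hdim j]
    congr 1
    -- Above level `i` the kernel of `p` on `X j` consists of the pairs `(0, w)` with `w` in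
    -- `flagKer W F i`.
    refine LinearEquiv.finrank_eq (LinearEquiv.ofBijective
      (LinearMap.codRestrict (flagKer W F i) (q ∘ₗ (X j).subtype ∘ₗ
        Submodule.subtype _) ?_) ⟨?_, ?_⟩)
    · intro z
      have h1 : p z.1.1 = 0 := z.2
      have h2 := hP z.1.1
      rw [h1, zero_sub, neg_mem_iff] at h2
      exact h2
    · intro z z' h
      have h1 : p z.1.1 = 0 := z.2
      have h1' : p z'.1.1 = 0 := z'.2
      exact Subtype.ext (Subtype.ext (hext' _ _ (h1.trans h1'.symm) (congrArg Subtype.val h)))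
    · intro w
      obtain ⟨z, hz1, hz2⟩ := hP' 0 w.1 w.2.1 (by rw [zero_sub, neg_mem_iff]; exact w.2.2)
      refine ⟨⟨⟨z, ?_⟩, hz1⟩, Subtype.ext hz2⟩
      rw [hX, hz1]
      exact ⟨zero_mem _, fun h => absurd h (by omega)⟩
  · rw [eq_top_iff]
    intro z _
    rw [hX, hj']
    exact ⟨trivial, fun h => absurd h (by omega)⟩
  · refine (flagIndex_le X Φ).trans ?_
    obtain ⟨s, hs'⟩ := p.exists_rightInverse_of_surjective (LinearMap.range_eq_top.2 hfst)
    have hs'' : ∀ u, p (s u) = u := fun u => LinearMap.congr_fun hs' u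
    -- an element of the stabilizer preserves the kernel of `p`
    have hker : ∀ x ∈ flagStab X Φ, ∀ z : P, p z = 0 → p (x z) = 0 := by
      rintro x ⟨h1, h2⟩ z hz
      have hzX : z ∈ X (i + 1) := by
        rw [hX, hz]
        exact ⟨zero_mem _, fun h => absurd h (by omega)⟩
      -- Since `Φ z = 0`, the stabilizer condition at level `i` puts `Φ (x z)` into the kernel of
      -- `q`. But `q (Φ (x z)) = π (p (x z)) = p (x z)`, as `p (x z)` lies in `W (i + 1)`.
      have h3 := ((hX _ _).1 (h2 i z hzX)).2 le_rfl
      have h4 : Φ z = 0 := hext _ (by rw [hΦ1, hz, map_zero]) (by rw [hΦ2, hz, map_zero])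
      rw [h4, map_zero, zero_sub, map_neg, neg_eq_zero, hΦ2,
        hπ2 _ ((hX _ _).1 (h1 _ z hzX)).1] at h3
      exact h3
    have hx' : ∀ x ∈ flagStab X Φ, ∀ z : P, p (x (s (p z))) = p (x z) := by
      intro x hx z
      have := hker x hx (s (p z) - z) (by rw [map_sub, hs'', sub_self])
      rw [map_sub, map_sub] at this
      exact sub_eq_zero.1 this
    let T : Module.End ℂ P →ₗ[ℂ] Module.End ℂ V :=
      { toFun := fun x => p ∘ₗ x ∘ₗ s
        map_add' := fun x y => by ext; simp
        map_smul' := fun t x => by ext; simp }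
    have hT : ∀ x u, T x u = p (x (s u)) := fun x u => rfl
    have hmaps : ∀ x ∈ flagStab X Φ, T x ∈ flagStab W F := by
      intro x hx
      refine ⟨fun j u hu => ?_, fun j u hu => ?_⟩
      · obtain ⟨z, hz, rfl⟩ := hlift j u hu
        rw [hT, hx' x hx]
        exact ((hX _ _).1 (hx.1 j z hz)).1
      · obtain ⟨z, hz, rfl⟩ := hlift (j + 1) u hu
        have := ((hX _ _).1 (hx.2 j z hz)).1
        rw [hT, hT, hx' x hx, ← hΦ1 z, hx' x hx, ← hΦ1, ← map_sub]
        exact this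
    refine Submodule.finrank_le_of_mapsTo T hmaps fun x hx hTx => ?_
    -- If `p ∘ x = 0`, then `x` vanishes on `X i` and on the image of `X (i + 1)` under `Φ`; these
    -- two span `P`.
    have h0 : ∀ z, p (x z) = 0 := fun z => by rw [← hx' x hx, ← hT, hTx]; rfl
    have hi : ∀ z ∈ X i, x z = 0 := fun z hz =>
      hext _ (h0 z) (((hX _ _).1 (hx.1 i z hz)).2 le_rfl)
    have hΦx : ∀ z, Φ (x z) = 0 := fun z =>
      hext _ (by rw [hΦ1, h0, map_zero]) (by rw [hΦ2, h0, map_zero])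
    have hi1 : ∀ z ∈ X (i + 1), x (Φ z) = 0 := by
      intro z hz
      have := hx.2 i z hz
      rw [hΦx, sub_zero] at this
      exact hext _ (h0 _) (((hX _ _).1 this).2 le_rfl)
    refine LinearMap.ext fun z => ?_
    obtain ⟨y, hy, hyz⟩ := hlift (i + 1) (q z) (hP z).1
    have hz : z - Φ y ∈ X i := by
      rw [hX, map_sub, map_sub, hΦ1, hΦ2, hyz, hπ2 _ (hP z).1, sub_self]
      exact ⟨(hP z).2, fun _ => rfl⟩
    have := hi _ hz
    rw [map_sub, hi1 y hy, sub_zero] at this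
    exact this

/-- If a filtration `Y` with the dimensions of the pullback filtration exists, then its index is at
most that of `W`. -/
theorem flagIndex_le_of_finrank_add {U : Type*} [AddCommGroup U] [Module ℂ U]
    [FiniteDimensional ℂ U] {W : ℕ → Submodule ℂ V} (hW : Monotone W) {Y : ℕ → Submodule ℂ U}
    (hY : Monotone Y) {i N : ℕ} {G : Module.End ℂ V} (hs : ∀ v, ∃ w ∈ W (i + 1), v - G w ∈ W i)
    (hN : i < N) (hWN : W N = ⊤) (hYN : Y N = ⊤)
    (h1 : ∀ j ≤ i, Module.finrank ℂ (Y j) = Module.finrank ℂ (W j))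
    (h2 : ∀ j, i < j → Module.finrank ℂ (Y j) + Module.finrank ℂ V = Module.finrank ℂ (W j) +
      (Module.finrank ℂ (W (i + 1)) + Module.finrank ℂ (W i))) :
    flagIndex Y ≤ flagIndex W := by
  obtain ⟨F, hF, hFs, -⟩ := exists_generic W i G hs
  let P : Submodule ℂ (V × V) :=
    (W (i + 1)).comap (LinearMap.snd ℂ V V) ⊓
      (W i).comap (LinearMap.fst ℂ V V - F ∘ₗ LinearMap.snd ℂ V V)
  obtain ⟨X, hX, hX1, hX2, hX3, hX4⟩ := exists_flag_of_pullback hW hFs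
    (LinearMap.fst ℂ V V ∘ₗ P.subtype) (LinearMap.snd ℂ V V ∘ₗ P.subtype)
    (fun z h h' => Subtype.ext (Prod.ext h h')) (fun z => z.2)
    (fun u w hw h => ⟨⟨(u, w), hw, h⟩, rfl, rfl⟩)
  rw [← hF]
  refine (flagIndex_le_of_finrank_eq hY hX (fun j => ?_) hYN (hX3 N hN hWN)).trans hX4
  rcases le_or_gt j i with hj | hj
  · rw [h1 j hj, hX1 j hj]
  · have := finrank_flagKer hFs
    have := h2 j hj
    rw [hX2 j hj]
    omega

end Reduction

/-! ### Shrinking a block by a quotient -/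

section Quotient

variable {V : Type*} [AddCommGroup V] [Module ℂ V] [FiniteDimensional ℂ V]

/-- With a section `σ` of `W (i + 1) → V ⧸ W i`, the map `v ↦ (π v, π (σ v))` embeds `V` into `Q ×
Q` as the pullback built from `Q`. A stabilizing `x` on `Q` acts on both coordinates and preserves
this pullback, hence lifts to `V`. -/
theorem flagIndex_map_le {Q : Type*} [AddCommGroup Q] [Module ℂ Q] [FiniteDimensional ℂ Q]
    {W : ℕ → Submodule ℂ V} (hW : Monotone W) {F : Module.End ℂ V} {i : ℕ}
    (hs : ∀ v, ∃ w ∈ W (i + 1), v - F w ∈ W i) (hinj : ∀ v ∈ W i, F v ∈ W i → v = 0)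
    (π : V →ₗ[ℂ] Q) (hπ : Function.Surjective π) (hker : LinearMap.ker π = flagKer W F i) :
    flagIndex (fun j => (W j).map π) ≤ Module.finrank ℂ (flagStab W F) := by
  have hK : ∀ v, π v = 0 ↔ v ∈ W (i + 1) ∧ F v ∈ W i := by
    intro v
    rw [← LinearMap.mem_ker, hker]
    rfl
  have hKeq : ∀ v w, v - w ∈ W (i + 1) → F v - F w ∈ W i → π v = π w := by
    intro v w h h'
    rw [← map_sub] at h'
    exact sub_eq_zero.1 (by rw [← map_sub, hK]; exact ⟨h, h'⟩)
  -- a section `σ` of the surjection `W (i + 1) → V ⧸ W i`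
  obtain ⟨σ, hσ1, hσ2⟩ : ∃ σ : Module.End ℂ V, (∀ v, σ v ∈ W (i + 1)) ∧
      ∀ v, F (σ v) - v ∈ W i := by
    have hsurj : Function.Surjective ((W i).mkQ ∘ₗ F ∘ₗ (W (i + 1)).subtype) := by
      intro q
      obtain ⟨v, rfl⟩ := (W i).mkQ_surjective q
      obtain ⟨w, hw, h⟩ := hs v
      exact ⟨⟨w, hw⟩, ((Submodule.Quotient.eq _).2 h).symm⟩
    obtain ⟨σ, hσ⟩ := LinearMap.exists_rightInverse_of_surjective _
      (LinearMap.range_eq_top.2 hsurj)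
    exact ⟨(W (i + 1)).subtype ∘ₗ σ ∘ₗ (W i).mkQ, fun v => (σ _).2,
      fun v => (Submodule.Quotient.eq _).1 (LinearMap.congr_fun hσ ((W i).mkQ v))⟩
  have hρF : ∀ v, ∀ w ∈ W (i + 1), v - F w ∈ W i → π (σ v) = π w := by
    intro v w hw h
    refine hKeq _ _ (sub_mem (hσ1 v) hw) ?_
    have := add_mem (hσ2 v) h
    rwa [sub_add_sub_cancel] at this
  have hρ0 : ∀ v, π (σ v) = 0 ↔ v ∈ W i := by
    intro v
    rw [hK]
    constructor
    · rintro ⟨-, h⟩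
      have := sub_mem h (hσ2 v)
      rwa [sub_sub_cancel] at this
    · intro h
      have := add_mem (hσ2 v) h
      rw [sub_add_cancel] at this
      exact ⟨hσ1 v, this⟩
  have hdis : Disjoint (W i) (LinearMap.ker π) := by
    rw [Submodule.disjoint_def]
    intro v hv hv'
    exact hinj v hv ((hK v).1 hv').2
  obtain ⟨C, hWC, hC⟩ := hdis.exists_isCompl
  let q : Module.End ℂ V := LinearMap.ofIsCompl hC 0 (LinearMap.ker π).subtype
  have hqW : ∀ v ∈ W i, q v = 0 := fun v hv => LinearMap.ofIsCompl_apply_left hC ⟨v, hWC hv⟩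
  have hqK : ∀ v, π v = 0 → q v = v := fun v hv =>
    LinearMap.ofIsCompl_apply_right hC (⟨v, hv⟩ : LinearMap.ker π)
  have hπq : ∀ v, π (q v) = 0 := by
    intro v
    obtain ⟨u, hu, k, hk, rfl⟩ := Submodule.mem_sup.1
      (hC.sup_eq_top ▸ Submodule.mem_top : v ∈ C ⊔ LinearMap.ker π)
    have : q u = 0 := LinearMap.ofIsCompl_apply_left hC ⟨u, hu⟩
    rw [map_add, this, zero_add, hqK k hk]
    exact hk
  obtain ⟨s, hs'⟩ := π.exists_rightInverse_of_surjective (LinearMap.range_eq_top.2 hπ)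
  have hs'' : ∀ u, π (s u) = u := fun u => LinearMap.congr_fun hs' u
  -- `F` need not descend to `Q`, but `F ∘ (1 - q)` does: `q` is a projection onto the kernel of
  -- `π`, so `v - q v` depends only on `π v`.
  obtain ⟨G, hG⟩ : ∃ G : Module.End ℂ Q, ∀ v, G (π v) = π (F (v - q v)) := by
    refine ⟨π ∘ₗ F ∘ₗ (LinearMap.id - q) ∘ₗ s, fun v => ?_⟩
    have h : q (s (π v) - v) = s (π v) - v := hqK _ (by rw [map_sub, hs'', sub_self])
    rw [map_sub] at h
    change π (F (s (π v) - q (s (π v)))) = _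
    congr 2
    exact sub_eq_sub_iff_sub_eq_sub.2 h.symm
  have hGW : ∀ v ∈ W i, G (π v) = π (F v) := fun v hv => by rw [hG, hqW v hv, sub_zero]
  -- The correction `q` vanishes on `W i`, and elsewhere it changes `F v` only by an element of `W
  -- i`, so the relevant induced maps are unaffected.
  have hGF : ∀ j, ∀ v ∈ W (j + 1), π (F v) - G (π v) ∈ (W j).map π := by
    intro j v hv
    rcases lt_or_ge j i with h | h
    · rw [hGW v (hW h hv), sub_self]
      exact zero_mem _
    · rw [hG, ← map_sub, ← map_sub, sub_sub_cancel]
      exact Submodule.mem_map_of_mem (hW h ((hK _).1 (hπq v)).2)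
  have hmem : ∀ j v, v ∈ W j ↔ π v ∈ (W j).map π ∧ (j ≤ i → π (σ v) = 0) := by
    intro j v
    constructor
    · intro hv
      exact ⟨Submodule.mem_map_of_mem hv, fun h => (hρ0 v).2 (hW h hv)⟩
    · rintro ⟨⟨w, hw, h⟩, h'⟩
      have hk : π (v - w) = 0 := by rw [map_sub, h, sub_self]
      rcases le_or_gt j i with hj | hj
      · have hv := (hρ0 v).1 (h' hj)
        have := hinj _ (sub_mem hv (hW hj hw)) ((hK _).1 hk).2
        rwa [sub_eq_zero.1 this]
      · have := add_mem (hW hj ((hK _).1 hk).1) hw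
        rwa [sub_add_cancel] at this
  have hext : ∀ v, π v = 0 → π (σ v) = 0 → v = 0 := fun v h h' =>
    hinj v ((hρ0 v).1 h') ((hK v).1 h).2
  have hlift : ∀ u w, w ∈ (W (i + 1)).map π → u - G w ∈ (W i).map π →
      ∃ v, π v = u ∧ π (σ v) = w := by
    rintro u _ ⟨w, hw, rfl⟩ h
    obtain ⟨v, rfl⟩ := hπ u
    have h1 := add_mem h (sub_mem (zero_mem _) (hGF i w hw))
    rw [zero_sub, neg_sub, sub_add_sub_cancel, ← map_sub] at h1
    obtain ⟨l, hl, hl'⟩ := h1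
    refine ⟨l + F w, ?_, ?_⟩
    · rw [map_add, hl', map_sub, sub_add_cancel]
    · exact hρF _ _ hw (by rwa [add_sub_cancel_right])
  obtain ⟨e, he⟩ : ∃ e : V →ₗ[ℂ] Q × Q, e = π.prod (π ∘ₗ σ) := ⟨_, rfl⟩
  have heinj : LinearMap.ker e = ⊥ := by
    rw [LinearMap.ker_eq_bot']
    intro v hv
    rw [he] at hv
    exact hext v (congrArg Prod.fst hv) (congrArg Prod.snd hv)
  obtain ⟨r, hr⟩ := e.exists_leftInverse_of_injective heinj
  let T : Module.End ℂ Q →ₗ[ℂ] Module.End ℂ V :=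
    { toFun := fun x => r ∘ₗ (x ∘ₗ π).prod (x ∘ₗ π ∘ₗ σ)
      map_add' := fun x y => by
        ext v
        exact map_add r (x (π v), x (π (σ v))) (y (π v), y (π (σ v)))
      map_smul' := fun t x => by
        ext v
        exact map_smul r t (x (π v), x (π (σ v))) }
  have hT : ∀ x v, T x v = r (x (π v), x (π (σ v))) := fun x v => rfl
  refine (flagIndex_le _ G).trans ?_
  -- For a stabilizing `x` the pair of coordinates lies in the image of `e`, where the retraction
  -- `r` is a true inverse.
  have hTx : ∀ x ∈ flagStab (fun j => (W j).map π) G, ∀ v,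
      π (T x v) = x (π v) ∧ π (σ (T x v)) = x (π (σ v)) := by
    intro x hx v
    obtain ⟨y, hy1, hy2⟩ := hlift (x (π v)) (x (π (σ v)))
      (hx.1 _ _ (Submodule.mem_map_of_mem (hσ1 v))) (by
        have h1 := hx.2 i _ (Submodule.mem_map_of_mem (hσ1 v))
        have h2 := hGF i _ (hσ1 v)
        have h3 : π (F (σ v)) - π v ∈ (W i).map π := by
          rw [← map_sub]
          exact Submodule.mem_map_of_mem (hσ2 v)
        have h4 := hx.1 i _ (sub_mem h2 h3)
        have h5 := sub_mem h1 (neg_mem h4)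
        convert h5 using 1
        simp only [map_sub]
        abel)
    have hy : T x v = y := by
      rw [hT, ← hy1, ← hy2]
      have := LinearMap.congr_fun hr y
      rw [he] at this
      exact this
    rw [hy]
    exact ⟨hy1, hy2⟩
  refine Submodule.finrank_le_of_mapsTo T (fun x hx => ⟨fun j v hv => ?_, fun j v hv => ?_⟩)
    fun x hx h0 => ?_
  · rw [hmem, (hTx x hx v).1, (hTx x hx v).2]
    refine ⟨hx.1 j _ (Submodule.mem_map_of_mem hv), fun h => ?_⟩
    rw [(hρ0 v).2 (hW h hv), map_zero]
  · have hTv : T x v ∈ W (j + 1) := by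
      rw [hmem, (hTx x hx v).1, (hTx x hx v).2]
      refine ⟨hx.1 _ _ (Submodule.mem_map_of_mem hv), fun h => ?_⟩
      rw [(hρ0 v).2 (hW h hv), map_zero]
    rw [hmem]
    constructor
    · rw [map_sub, (hTx x hx _).1]
      have h1 := hx.1 j _ (hGF j v hv)
      have h2 := hGF j _ hTv
      have h3 := hx.2 j _ (Submodule.mem_map_of_mem hv)
      rw [(hTx x hx v).1] at h2
      convert add_mem (sub_mem h1 h2) h3 using 1
      rw [map_sub]
      abel
    · intro h
      have hv' : v ∈ W (i + 1) := hW (by omega) hv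
      have hTv' : T x v ∈ W (i + 1) := hW (by omega) hTv
      rw [map_sub, map_sub, (hTx x hx _).2, hρF _ v hv' (by rw [sub_self]; exact zero_mem _),
        hρF _ _ hTv' (by rw [sub_self]; exact zero_mem _), (hTx x hx v).1, sub_self]
  · refine LinearMap.ext fun u => ?_
    obtain ⟨v, rfl⟩ := hπ u
    rw [← (hTx x hx v).1, h0]
    exact map_zero π

/-- If a filtration `Y` exists whose dimensions are those of the images in the quotient by the
kernel of a generic map `W (i + 1) → V ⧸ W i`, then its index is at most that of `W`. -/
theorem flagIndex_le_of_finrank_sub {U : Type*} [AddCommGroup U] [Module ℂ U]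
    [FiniteDimensional ℂ U] {W : ℕ → Submodule ℂ V} (hW : Monotone W) {Y : ℕ → Submodule ℂ U}
    (hY : Monotone Y) {i N : ℕ} {G : Module.End ℂ V} (hs : ∀ v, ∃ w ∈ W (i + 1), v - G w ∈ W i)
    (hinj : ∀ v ∈ W i, G v ∈ W i → v = 0) (hWN : W N = ⊤) (hYN : Y N = ⊤)
    (h1 : ∀ j ≤ i, Module.finrank ℂ (Y j) = Module.finrank ℂ (W j))
    (h2 : ∀ j, i < j → Module.finrank ℂ (Y j) + (Module.finrank ℂ (W (i + 1)) +
      Module.finrank ℂ (W i)) = Module.finrank ℂ (W j) + Module.finrank ℂ V) :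
    flagIndex Y ≤ flagIndex W := by
  obtain ⟨F, hF, hFs, hFi⟩ := exists_generic W i G hs
  have hFi := hFi hinj
  have hker : LinearMap.ker (flagKer W F i).mkQ = flagKer W F i := Submodule.ker_mkQ _
  rw [← hF]
  refine (flagIndex_le_of_finrank_eq hY (fun j k hjk => Submodule.map_mono (hW hjk))
    (fun j => ?_) hYN ?_).trans
    (flagIndex_map_le hW hFs hFi (flagKer W F i).mkQ (Submodule.mkQ_surjective _) hker)
  · have h3 := LinearMap.finrank_range_add_finrank_ker ((flagKer W F i).mkQ.domRestrict (W j))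
    rw [LinearMap.range_domRestrict] at h3
    have h4 : LinearMap.ker ((flagKer W F i).mkQ.domRestrict (W j)) =
        (flagKer W F i).comap (W j).subtype := by
      ext v
      simp
    rw [h4] at h3
    rcases le_or_gt j i with hj | hj
    · have h5 : (flagKer W F i).comap (W j).subtype = ⊥ := by
        rw [eq_bot_iff]
        intro v hv
        exact Subtype.ext (hFi _ (hW hj v.2) hv.2)
      rw [h5, finrank_bot] at h3
      rw [h1 j hj]
      exact h3.symm
    · have h5 : Module.finrank ℂ ((flagKer W F i).comap (W j).subtype) =
          Module.finrank ℂ (flagKer W F i) := (Submodule.comapSubtypeEquivOfLe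
        (inf_le_left.trans (hW hj) : flagKer W F i ≤ W j)).finrank_eq
      have h6 := finrank_flagKer hFs
      have h7 := h2 j hj
      rw [h5] at h3
      omega
  · rw [hWN, Submodule.map_top, Submodule.range_mkQ]

end Quotient

/-! ### From coadjoint stabilizers of block triangular algebras to flags -/

section Matrices

theorem lieIndex_le_finrank {K L : Type*} [Field K] [LieRing L] [LieAlgebra K L]
    [FiniteDimensional K L] (f : Module.Dual K L) :
    lieIndex K L ≤ Module.finrank K (coadjointStabilizer f) :=
  Nat.sInf_le ⟨f, rfl⟩

theorem exists_finrank_coadjointStabilizer_eq (K L : Type*) [Field K] [LieRing L] [LieAlgebra K L]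
    [FiniteDimensional K L] :
    ∃ f : Module.Dual K L, Module.finrank K (coadjointStabilizer f) = lieIndex K L :=
  Nat.sInf_mem (s := {d : ℕ | ∃ f : Module.Dual K L,
    Module.finrank K (coadjointStabilizer f) = d}) ⟨_, 0, rfl⟩

theorem lieIndex_le_of_antiequiv {K L L' : Type*} [Field K] [LieRing L] [LieAlgebra K L]
    [FiniteDimensional K L] [LieRing L'] [LieAlgebra K L'] [FiniteDimensional K L']
    (e : L ≃ₗ[K] L') (he : ∀ x y, e ⁅x, y⁆ = ⁅e y, e x⁆) : lieIndex K L ≤ lieIndex K L' := by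
  obtain ⟨f, hf⟩ := exists_finrank_coadjointStabilizer_eq K L'
  rw [← hf]
  refine (lieIndex_le_finrank (f ∘ₗ e.toLinearMap)).trans ?_
  refine Submodule.finrank_le_of_mapsTo e.toLinearMap (fun x hx y => ?_)
    fun x _ hx => e.map_eq_zero_iff.1 hx
  obtain ⟨y, rfl⟩ := e.surjective y
  have := hx y
  rw [LinearMap.comp_apply, LinearEquiv.coe_coe, he, ← lie_skew, map_neg, neg_eq_zero] at this
  exact this

variable {ι : Type*}

/-- The filtration of `ι → ℂ` by the subspaces of the vectors supported on `b < j`. -/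
def stdFlag (b : ι → ℕ) (j : ℕ) : Submodule ℂ (ι → ℂ) where
  carrier := {v | ∀ p, j ≤ b p → v p = 0}
  add_mem' := by
    intro v w hv hw p hp
    rw [Pi.add_apply, hv p hp, hw p hp, add_zero]
  zero_mem' := fun p _ => rfl
  smul_mem' := by
    intro t v hv p hp
    rw [Pi.smul_apply, hv p hp, smul_zero]

theorem mem_stdFlag {b : ι → ℕ} {j : ℕ} {v : ι → ℂ} :
    v ∈ stdFlag b j ↔ ∀ p, j ≤ b p → v p = 0 := Iff.rfl

theorem stdFlag_mono (b : ι → ℕ) : Monotone (stdFlag b) :=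
  fun _ _ hjk _ hv p hp => hv p (hjk.trans hp)

variable [Fintype ι]

theorem finrank_stdFlag (b : ι → ℕ) (j : ℕ) :
    Module.finrank ℂ (stdFlag b j) = Fintype.card {p // b p < j} := by
  have h : stdFlag b j = ⨅ p ∈ {p | j ≤ b p}, LinearMap.ker (LinearMap.proj p : (ι → ℂ) →ₗ[ℂ] ℂ) := by
    ext v
    simp [mem_stdFlag]
  have e := LinearMap.iInfKerProjEquiv ℂ (fun _ : ι => ℂ) (I := {p | b p < j}) (J := {p | j ≤ b p})
    (by
      rw [Set.disjoint_left]
      intro p (h1 : b p < j) (h2 : j ≤ b p)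
      omega)
    (by
      intro p _
      exact lt_or_ge (b p) j)
  rw [h, e.finrank_eq]
  exact Module.finrank_fintype_fun_eq_card ℂ

variable [DecidableEq ι]

/-- The Lie algebra of block triangular matrices with respect to `b`. -/
def blockTriangularLie (b : ι → ℕ) : LieSubalgebra ℂ (Matrix ι ι ℂ) where
  carrier := {M | M.BlockTriangular b}
  add_mem' := fun hM hN => hM.add hN
  zero_mem' := Matrix.blockTriangular_zero
  smul_mem' := by
    intro t M hM i j hij
    rw [Matrix.smul_apply, hM hij, smul_zero]
  lie_mem' := by
    intro M N hM hN
    exact (hM.mul hN).sub (hN.mul hM)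

theorem mulVec_mem_stdFlag_iff (b : ι → ℕ) (M : Matrix ι ι ℂ) :
    (∀ j, ∀ v ∈ stdFlag b j, M.mulVec v ∈ stdFlag b j) ↔ M.BlockTriangular b := by
  constructor
  · intro h p q hqp
    have h1 : Pi.single q (1 : ℂ) ∈ stdFlag b (b q + 1) := by
      intro k hk
      rw [Pi.single_apply, if_neg]
      rintro rfl
      omega
    have := h _ _ h1 p hqp
    rwa [Matrix.mulVec_single_one] at this
  · intro h j v hv p hp
    refine Finset.sum_eq_zero fun q _ => ?_
    change M p q * v q = 0
    rcases le_or_gt j (b q) with hq | hq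
    · rw [hv q hq, mul_zero]
    · rw [h (hq.trans_le hp), zero_mul]

theorem mulVec_mem_stdFlag_pred_iff (b : ι → ℕ) (M : Matrix ι ι ℂ) :
    (∀ j, ∀ v ∈ stdFlag b (j + 1), M.mulVec v ∈ stdFlag b j) ↔ ∀ p q, b q ≤ b p → M p q = 0 := by
  constructor
  · intro h p q hqp
    have h1 : Pi.single q (1 : ℂ) ∈ stdFlag b (b q + 1) := by
      intro k hk
      rw [Pi.single_apply, if_neg]
      rintro rfl
      omega
    have := h _ _ h1 p hqp
    rwa [Matrix.mulVec_single_one] at this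
  · intro h j v hv p hp
    refine Finset.sum_eq_zero fun q _ => ?_
    change M p q * v q = 0
    rcases le_or_gt (j + 1) (b q) with hq | hq
    · rw [hv q hq, mul_zero]
    · rw [h p q (by omega), zero_mul]

/-- Testing against the matrix units of the block triangular algebra shows that its orthogonal under
the trace form is its nilradical. -/
theorem forall_trace_mul_blockTriangular_eq_zero_iff (b : ι → ℕ) (M : Matrix ι ι ℂ) :
    (∀ y ∈ blockTriangularLie b, (M * y).trace = 0) ↔ ∀ p q, b q ≤ b p → M p q = 0 := by
  constructor
  · intro h p q hqp
    have h1 : Matrix.single q p (1 : ℂ) ∈ blockTriangularLie b := by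
      intro k l hkl
      rw [Matrix.single_apply, if_neg]
      rintro ⟨rfl, rfl⟩
      omega
    have := h _ h1
    rwa [Matrix.trace_mul_single, MulOpposite.op_one, one_smul] at this
  · intro h y hy
    refine Finset.sum_eq_zero fun p _ => Finset.sum_eq_zero fun q _ => ?_
    change M p q * y q p = 0
    rcases le_or_gt (b q) (b p) with hq | hq
    · rw [h p q hq, zero_mul]
    · rw [hy hq, mul_zero]

theorem exists_trace_mul_eq (f : Module.Dual ℂ (Matrix ι ι ℂ)) :
    ∃ F : Matrix ι ι ℂ, ∀ M, f M = (F * M).trace := by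
  refine ⟨Matrix.of fun p q => f (Matrix.single q p 1), fun M => ?_⟩
  have : f = Matrix.traceLinearMap ι ℂ ℂ ∘ₗ
      LinearMap.mulLeft ℂ (Matrix.of fun p q => f (Matrix.single q p 1)) := by
    refine (Matrix.stdBasis ℂ ι ι).ext fun ⟨p, q⟩ => ?_
    rw [Matrix.stdBasis_eq_single]
    simp [Matrix.trace_mul_single]
  exact LinearMap.congr_fun this M

/-- Since `tr (F [x, y]) = -tr ([x, F] y)`, the form kills all `[x, y]` exactly when `[x, F]` is
strictly block triangular, that is, maps each `W (j + 1)` into `W j`. -/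
theorem finrank_coadjointStabilizer_eq (b : ι → ℕ) (F : Matrix ι ι ℂ)
    (f : Module.Dual ℂ (blockTriangularLie b)) (hf : ∀ x, f x = (F * x.1).trace) :
    Module.finrank ℂ (coadjointStabilizer f) =
      Module.finrank ℂ (flagStab (stdFlag b) (Matrix.toLin' F)) := by
  let T : blockTriangularLie b →ₗ[ℂ] Module.End ℂ (ι → ℂ) :=
    (Matrix.toLin' : Matrix ι ι ℂ ≃ₗ[ℂ] _).toLinearMap ∘ₗ
      (blockTriangularLie b).toSubmodule.subtype
  have hT : Function.Injective T := fun x y h => Subtype.ext (Matrix.toLin'.injective h)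
  rw [(Submodule.equivMapOfInjective T hT (coadjointStabilizer f)).finrank_eq]
  suffices h : (coadjointStabilizer f).map T = flagStab (stdFlag b) (Matrix.toLin' F) by rw [h]
  have key : ∀ x : Matrix ι ι ℂ, (∀ j, ∀ v ∈ stdFlag b (j + 1),
      Matrix.toLin' x (Matrix.toLin' F v) - Matrix.toLin' F (Matrix.toLin' x v) ∈ stdFlag b j) ↔
      ∀ y ∈ blockTriangularLie b, (F * (x * y - y * x)).trace = 0 := by
    intro x
    have h1 : ∀ v, Matrix.toLin' x (Matrix.toLin' F v) - Matrix.toLin' F (Matrix.toLin' x v) =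
        (x * F - F * x).mulVec v := by
      intro v
      simp [Matrix.sub_mulVec]
    have h2 : ∀ y, (F * (x * y - y * x)).trace = -((x * F - F * x) * y).trace := by
      intro y
      rw [Matrix.mul_sub, Matrix.sub_mul, Matrix.trace_sub, Matrix.trace_sub, ← Matrix.mul_assoc F y,
        Matrix.trace_mul_comm (F * y) x, ← Matrix.mul_assoc, ← Matrix.mul_assoc, neg_sub]
    simp only [h1, h2, neg_eq_zero]
    rw [mulVec_mem_stdFlag_pred_iff, forall_trace_mul_blockTriangular_eq_zero_iff]
  ext X
  constructor
  · rintro ⟨x, hx, rfl⟩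
    refine ⟨(mulVec_mem_stdFlag_iff b x.1).2 x.2, (key x.1).2 fun y hy => ?_⟩
    rw [← hx ⟨y, hy⟩, hf]
    rfl
  · rintro ⟨h1, h2⟩
    obtain ⟨x, rfl⟩ := (Matrix.toLin' : Matrix ι ι ℂ ≃ₗ[ℂ] _).surjective X
    refine ⟨⟨x, (mulVec_mem_stdFlag_iff b x).1 h1⟩, fun y => ?_, rfl⟩
    rw [hf]
    exact (key x).1 h2 y y.2

theorem lieIndex_blockTriangularLie (b : ι → ℕ) :
    lieIndex ℂ (blockTriangularLie b) = flagIndex (stdFlag b) := by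
  apply le_antisymm
  · obtain ⟨F, hF⟩ := exists_finrank_flagStab_eq (stdFlag b)
    obtain ⟨F, rfl⟩ := (Matrix.toLin' : Matrix ι ι ℂ ≃ₗ[ℂ] _).surjective F
    rw [← hF, ← finrank_coadjointStabilizer_eq b F (Matrix.traceLinearMap ι ℂ ℂ ∘ₗ
      LinearMap.mulLeft ℂ F ∘ₗ (blockTriangularLie b).toSubmodule.subtype) fun x => rfl]
    exact lieIndex_le_finrank _
  · obtain ⟨f, hf⟩ := exists_finrank_coadjointStabilizer_eq ℂ (blockTriangularLie b)
    obtain ⟨g, hg⟩ := LinearMap.exists_extend (p := (blockTriangularLie b).toSubmodule) f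
    obtain ⟨F, hF⟩ := exists_trace_mul_eq g
    rw [← hf, finrank_coadjointStabilizer_eq b F f fun x => by rw [← hF, ← hg]; rfl]
    exact flagIndex_le _ _

theorem blockTriangularLie_congr {b b' : ι → ℕ} (h : ∀ p q, b p < b q ↔ b' p < b' q) :
    blockTriangularLie b = blockTriangularLie b' := by
  ext M
  exact forall₂_congr fun p q => by rw [h]

/-- Transposition in the antidiagonal is an anti-isomorphism between the two algebras. -/
theorem lieIndex_le_of_rev {n : ℕ} {b b' : Fin n → ℕ}
    (h : ∀ p q, b p < b q ↔ b' q.rev < b' p.rev) :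
    lieIndex ℂ (blockTriangularLie b) ≤ lieIndex ℂ (blockTriangularLie b') := by
  let e : blockTriangularLie b ≃ₗ[ℂ] blockTriangularLie b' :=
    { toFun := fun x => ⟨x.1.transpose.submatrix Fin.rev Fin.rev, fun p q hpq =>
        x.2 ((h _ _).2 (by simpa using hpq))⟩
      invFun := fun x => ⟨x.1.transpose.submatrix Fin.rev Fin.rev, fun p q hpq =>
        x.2 ((h _ _).1 hpq)⟩
      map_add' := fun x y => rfl
      map_smul' := fun t x => rfl
      left_inv := fun x => Subtype.ext (by ext p q; simp)
      right_inv := fun x => Subtype.ext (by ext p q; simp) }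
  refine lieIndex_le_of_antiequiv e fun x y => Subtype.ext ?_
  change ((x.1 * y.1 - y.1 * x.1).transpose).submatrix Fin.revPerm Fin.revPerm =
    y.1.transpose.submatrix Fin.revPerm Fin.revPerm * x.1.transpose.submatrix Fin.revPerm Fin.revPerm -
    x.1.transpose.submatrix Fin.revPerm Fin.revPerm * y.1.transpose.submatrix Fin.revPerm Fin.revPerm
  rw [Matrix.submatrix_mul_equiv, Matrix.submatrix_mul_equiv, Matrix.transpose_sub,
    Matrix.transpose_mul, Matrix.transpose_mul]
  rfl

end Matrices

/-! ### Block sizes, reversal and growth of one block -/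

section Blocks

theorem blockNumber_lt_iff (a : List ℕ) (p j : ℕ) (hp : p < a.sum) :
    blockNumber a p < j ↔ p < (a.take j).sum := by
  induction a generalizing p j with
  | nil => simp at hp
  | cons a l ih =>
    rw [List.sum_cons] at hp
    cases j with
    | zero => simp
    | succ j =>
      rw [List.take_succ_cons, List.sum_cons, blockNumber]
      split_ifs with h
      · simp only [Nat.zero_lt_succ, true_iff]; omega
      · rw [Nat.add_lt_add_iff_right, ih _ _ (by omega)]; omega

/-- Separation by a partial sum is a symmetric description of the order of blocks, convenient for
reversing the list. -/
theorem blockNumber_lt_blockNumber_iff (a : List ℕ) {p q : ℕ} (hp : p < a.sum) (hq : q < a.sum) :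
    blockNumber a p < blockNumber a q ↔ ∃ j, p < (a.take j).sum ∧ (a.take j).sum ≤ q := by
  constructor
  · intro h
    refine ⟨blockNumber a q, (blockNumber_lt_iff a p _ hp).1 h, ?_⟩
    rw [← not_lt, ← blockNumber_lt_iff a q _ hq]
    exact lt_irrefl _
  · rintro ⟨j, h1, h2⟩
    rw [← blockNumber_lt_iff a p _ hp] at h1
    rw [← not_lt, ← blockNumber_lt_iff a q _ hq] at h2
    omega

theorem blockNumber_zero_lt_iff (l r : List ℕ) (p q : ℕ) :
    blockNumber (l ++ 0 :: r) p < blockNumber (l ++ 0 :: r) q ↔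
      blockNumber (l ++ r) p < blockNumber (l ++ r) q := by
  induction l generalizing p q with
  | nil => simp [blockNumber]
  | cons a l ih =>
    simp only [List.cons_append, blockNumber]
    split_ifs <;> simp [ih]

theorem sum_take_reverse (a : List ℕ) (j : ℕ) :
    (a.reverse.take j).sum + (a.take (a.length - j)).sum = a.sum := by
  rw [List.take_reverse, List.sum_reverse, add_comm]
  exact List.sum_take_add_sum_drop a _

theorem blockNumber_reverse_lt_iff (a : List ℕ) {p q : ℕ} (hp : p < a.sum) (hq : q < a.sum) :
    blockNumber a.reverse p < blockNumber a.reverse q ↔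
      blockNumber a (a.sum - 1 - q) < blockNumber a (a.sum - 1 - p) := by
  rw [blockNumber_lt_blockNumber_iff _ (by rwa [List.sum_reverse]) (by rwa [List.sum_reverse]),
    blockNumber_lt_blockNumber_iff _ (by omega) (by omega)]
  constructor
  · rintro ⟨j, h1, h2⟩
    have := sum_take_reverse a j
    exact ⟨a.length - j, by omega, by omega⟩
  · rintro ⟨j, h1, h2⟩
    have := sum_take_reverse a.reverse j
    rw [List.reverse_reverse, List.sum_reverse, List.length_reverse] at this
    exact ⟨a.length - j, by omega, by omega⟩

theorem sum_take_append_cons (l r : List ℕ) (m j : ℕ) :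
    ((l ++ m :: r).take j).sum = if j ≤ l.length then (l.take j).sum
      else l.sum + m + (r.take (j - l.length - 1)).sum := by
  rw [List.take_append, List.sum_append]
  split_ifs with h
  · rw [Nat.sub_eq_zero_of_le h, List.take_zero, List.sum_nil, add_zero]
  · obtain ⟨k, hk⟩ : ∃ k, j - l.length = k + 1 := ⟨j - l.length - 1, by omega⟩
    rw [hk, List.take_succ_cons, List.sum_cons, List.take_of_length_le (by omega), add_assoc]
    rfl

theorem lieIndex_blockTriangularLie_eq {n n' : ℕ} (hn : n = n') {b b' : ℕ → ℕ}
    (h : ∀ p q, b p < b q ↔ b' p < b' q) :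
    lieIndex ℂ (blockTriangularLie fun i : Fin n => b i) =
      lieIndex ℂ (blockTriangularLie fun i : Fin n' => b' i) := by
  subst hn
  rw [blockTriangularLie_congr fun p q : Fin n => h p q]

theorem lieIndex_parabolic_zero (l r : List ℕ) :
    lieIndex ℂ (parabolic (l ++ 0 :: r)) = lieIndex ℂ (parabolic (l ++ r)) :=
  lieIndex_blockTriangularLie_eq (by simp) (blockNumber_zero_lt_iff l r)

theorem lieIndex_blockTriangularLie_le_of_rev {n n' : ℕ} (hn : n = n') {b b' : ℕ → ℕ}
    (h : ∀ p q, p < n → q < n → (b p < b q ↔ b' (n - 1 - q) < b' (n - 1 - p))) :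
    lieIndex ℂ (blockTriangularLie fun i : Fin n => b i) ≤
      lieIndex ℂ (blockTriangularLie fun i : Fin n' => b' i) := by
  subst hn
  refine lieIndex_le_of_rev fun p q => ?_
  rw [h p q p.2 q.2, Fin.val_rev, Fin.val_rev, Nat.sub_sub, Nat.sub_sub, add_comm 1, add_comm 1]

theorem lieIndex_parabolic_reverse_le (a : List ℕ) :
    lieIndex ℂ (parabolic a.reverse) ≤ lieIndex ℂ (parabolic a) :=
  lieIndex_blockTriangularLie_le_of_rev a.sum_reverse fun p q hp hq => by
    rw [List.sum_reverse] at hp hq ⊢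
    exact blockNumber_reverse_lt_iff a hp hq

theorem lieIndex_parabolic_reverse (a : List ℕ) :
    lieIndex ℂ (parabolic a.reverse) = lieIndex ℂ (parabolic a) := by
  refine le_antisymm (lieIndex_parabolic_reverse_le a) ?_
  have := lieIndex_parabolic_reverse_le a.reverse
  rwa [List.reverse_reverse] at this

/-- The filtration of `ℂ ^ n` which is preserved by the parabolic subalgebra `𝔭(a₁, …, aₖ)`. -/
def blockFlag (a : List ℕ) : ℕ → Submodule ℂ (Fin a.sum → ℂ) :=
  stdFlag fun i : Fin a.sum => blockNumber a i

theorem blockFlag_mono (a : List ℕ) : Monotone (blockFlag a) := stdFlag_mono _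

theorem lieIndex_parabolic (a : List ℕ) :
    lieIndex ℂ (parabolic a) = flagIndex (blockFlag a) :=
  lieIndex_blockTriangularLie _

theorem mem_blockFlag {a : List ℕ} {j : ℕ} {v : Fin a.sum → ℂ} :
    v ∈ blockFlag a j ↔ ∀ p : Fin a.sum, (a.take j).sum ≤ p → v p = 0 := by
  refine forall_congr' fun p => ?_
  rw [← not_lt, ← not_lt, blockNumber_lt_iff a p j p.2]

theorem sum_take_le (a : List ℕ) (j : ℕ) : (a.take j).sum ≤ a.sum := by
  have := List.sum_take_add_sum_drop a j
  omega

theorem finrank_blockFlag (a : List ℕ) (j : ℕ) :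
    Module.finrank ℂ (blockFlag a j) = (a.take j).sum := by
  rw [blockFlag, finrank_stdFlag]
  have e : {p : Fin a.sum // blockNumber a p < j} ≃ Fin (a.take j).sum :=
    { toFun := fun p => ⟨p.1, (blockNumber_lt_iff a p.1 j p.1.2).1 p.2⟩
      invFun := fun p => ⟨⟨p, p.2.trans_le (sum_take_le a j)⟩,
        (blockNumber_lt_iff a p j (p.2.trans_le (sum_take_le a j))).2 p.2⟩
      left_inv := fun p => rfl
      right_inv := fun p => rfl }
  rw [Fintype.card_congr e, Fintype.card_fin]

theorem blockFlag_eq_top {a : List ℕ} {j : ℕ} (h : a.length ≤ j) : blockFlag a j = ⊤ := by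
  rw [eq_top_iff]
  intro v _
  rw [mem_blockFlag, List.take_of_length_le h]
  intro p hp
  exact absurd p.2 (by omega)

/-- The shift by `s` coordinates. -/
def shift (n s : ℕ) : Module.End ℂ (Fin n → ℂ) where
  toFun v p := if h : s ≤ p then v ⟨p - s, by omega⟩ else 0
  map_add' v w := by
    ext p
    by_cases h : s ≤ p <;> simp [h]
  map_smul' t v := by
    ext p
    by_cases h : s ≤ p <;> simp [h]

theorem shift_apply {n s : ℕ} (v : Fin n → ℂ) {p : Fin n} (h : s ≤ p) :
    shift n s v p = v ⟨p - s, by omega⟩ := dif_pos h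

/-- The hypothesis says `dim V ⧸ W i ≤ dim W (i + 1)`. The shift is then an explicit map inducing a
surjection, so generic maps do too. -/
theorem shift_surjective_blockFlag {a : List ℕ} {i : ℕ}
    (h : a.sum ≤ (a.take (i + 1)).sum + (a.take i).sum) (v : Fin a.sum → ℂ) :
    ∃ w ∈ blockFlag a (i + 1), v - shift a.sum (a.take i).sum w ∈ blockFlag a i := by
  refine ⟨fun p => if hp : p + (a.take i).sum < a.sum then v ⟨p + (a.take i).sum, hp⟩ else 0, ?_, ?_⟩
  · rw [mem_blockFlag]
    intro p hp
    exact dif_neg (by omega)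
  · rw [mem_blockFlag]
    intro p hp
    rw [Pi.sub_apply, shift_apply _ hp]
    simp [Nat.sub_add_cancel hp]

theorem shift_injective_blockFlag {a : List ℕ} {i : ℕ}
    (h : (a.take i).sum + (a.take i).sum ≤ a.sum) (v : Fin a.sum → ℂ) (hv : v ∈ blockFlag a i)
    (hv' : shift a.sum (a.take i).sum v ∈ blockFlag a i) : v = 0 := by
  rw [mem_blockFlag] at hv hv'
  ext p
  rcases le_or_gt (a.take i).sum p with hp | hp
  · exact hv p hp
  · have := hv' ⟨p + (a.take i).sum, by omega⟩ (Nat.le_add_left _ _)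
    rw [shift_apply _ (Nat.le_add_left _ _)] at this
    simpa using this

/-- For both block sizes, `d` is the excess of `dim W (i + 1)` over `dim V ⧸ W i`, where `i =
l.length`. The pullback gives one inequality and the quotient the other. -/
theorem lieIndex_parabolic_add_of_sum_eq (l r : List ℕ) (m d : ℕ) (h : l.sum = r.sum + d) :
    lieIndex ℂ (parabolic (l ++ (m + d) :: r)) = lieIndex ℂ (parabolic (l ++ m :: r)) := by
  rw [lieIndex_parabolic, lieIndex_parabolic]
  have s0 : ∀ k, (l ++ k :: r).sum = l.sum + (k + r.sum) := by simp
  have s1 : ∀ k, ((l ++ k :: r).take l.length).sum = l.sum := by simp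
  have s2 : ∀ k, ((l ++ k :: r).take (l.length + 1)).sum = l.sum + k := by
    intro k
    rw [sum_take_append_cons, if_neg (by omega)]
    simp
  have s3 : ∀ j ≤ l.length, ∀ k k', ((l ++ k :: r).take j).sum = ((l ++ k' :: r).take j).sum := by
    intro j hj k k'
    rw [sum_take_append_cons, sum_take_append_cons, if_pos hj, if_pos hj]
  have s4 : ∀ j, l.length < j →
      ((l ++ (m + d) :: r).take j).sum = ((l ++ m :: r).take j).sum + d := by
    intro j hj
    rw [sum_take_append_cons, sum_take_append_cons, if_neg (by omega), if_neg (by omega)]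
    omega
  have hlen : ∀ k, (l ++ k :: r).length ≤ l.length + r.length + 1 := by
    intro k
    simp
    omega
  apply le_antisymm
  · refine flagIndex_le_of_finrank_add (i := l.length) (N := l.length + r.length + 1)
      (blockFlag_mono _) (blockFlag_mono _)
      (shift_surjective_blockFlag (a := l ++ m :: r) (by rw [s0, s1, s2]; omega)) (by omega)
      (blockFlag_eq_top (hlen _)) (blockFlag_eq_top (hlen _)) (fun j hj => ?_) (fun j hj => ?_)
    · rw [finrank_blockFlag, finrank_blockFlag, s3 j hj]
    · rw [finrank_blockFlag, finrank_blockFlag, finrank_blockFlag, finrank_blockFlag, s4 j hj, s1,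
        s2, Module.finrank_fintype_fun_eq_card, Fintype.card_fin, s0]
      omega
  · refine flagIndex_le_of_finrank_sub (i := l.length) (N := l.length + r.length + 1)
      (blockFlag_mono _) (blockFlag_mono _)
      (shift_surjective_blockFlag (a := l ++ (m + d) :: r) (by rw [s0, s1, s2]; omega))
      (shift_injective_blockFlag (a := l ++ (m + d) :: r) (by rw [s0, s1]; omega))
      (blockFlag_eq_top (hlen _)) (blockFlag_eq_top (hlen _)) (fun j hj => ?_) (fun j hj => ?_)
    · rw [finrank_blockFlag, finrank_blockFlag, s3 j hj]
    · rw [finrank_blockFlag, finrank_blockFlag, finrank_blockFlag, finrank_blockFlag, s4 j hj, s1,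
        s2, Module.finrank_fintype_fun_eq_card, Fintype.card_fin, s0]
      omega

/-- The index of a parabolic subalgebra of `𝔤𝔩(n, ℂ)` does not change if a block grows by the
difference of the sums of the blocks before and after it. -/
theorem lieIndex_parabolic_add (l r : List ℕ) (m : ℕ) :
    lieIndex ℂ (parabolic (l ++ (m + ((l.sum : ℤ) - r.sum).natAbs) :: r)) =
      lieIndex ℂ (parabolic (l ++ m :: r)) := by
  rcases le_total r.sum l.sum with h | h
  · exact lieIndex_parabolic_add_of_sum_eq l r m _ (by omega)
  · have := lieIndex_parabolic_add_of_sum_eq r.reverse l.reverse m ((l.sum : ℤ) - r.sum).natAbs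
      (by rw [List.sum_reverse, List.sum_reverse]; omega)
    have e : ∀ k, (l ++ k :: r).reverse = r.reverse ++ k :: l.reverse := by simp
    rw [← lieIndex_parabolic_reverse, ← lieIndex_parabolic_reverse (l ++ m :: r), e, e, this]

/-- Growth starts from an invisible block of size zero; the increment does not involve the block
itself, so it can be repeated. -/
theorem lieIndex_parabolic_mul (l r : List ℕ) (k : ℕ) :
    lieIndex ℂ (parabolic (l ++ (k * ((l.sum : ℤ) - r.sum).natAbs) :: r)) =
      lieIndex ℂ (parabolic (l ++ r)) := by
  induction k with
  | zero => rw [zero_mul, lieIndex_parabolic_zero]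
  | succ k ih => rw [Nat.succ_mul, lieIndex_parabolic_add, ih]

end Blocks

/-! ### Index one, the Euclidean algorithm and Frobenius algebras -/

section Frobenius

theorem lieIndex_parabolic_of_sum_eq_one {a : List ℕ} (h : a.sum = 1) :
    lieIndex ℂ (parabolic a) = 1 := by
  have hsub : Subsingleton (Fin a.sum) := by rw [h]; infer_instance
  have hcard : Fintype.card (Fin a.sum) = 1 := by rw [Fintype.card_fin, h]
  have htop : (parabolic a).toSubmodule = ⊤ := by
    rw [eq_top_iff]
    intro M _ i j hij
    rw [Subsingleton.elim i j] at hij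
    exact absurd hij (lt_irrefl _)
  have hfin : Module.finrank ℂ (parabolic a) = 1 := by
    change Module.finrank ℂ (parabolic a).toSubmodule = 1
    rw [htop, finrank_top, Module.finrank_matrix, hcard, Module.finrank_self]
  obtain ⟨f, hf⟩ := exists_finrank_coadjointStabilizer_eq ℂ (parabolic a)
  have hstab : coadjointStabilizer f = ⊤ := by
    rw [eq_top_iff]
    intro x _ y
    have : ⁅x, y⁆ = 0 := by
      refine Subtype.ext (Matrix.ext fun i j => ?_)
      change (x.1 * y.1 - y.1 * x.1) i j = 0
      rw [Matrix.sub_apply, Matrix.mul_apply, Matrix.mul_apply, ← Finset.sum_sub_distrib]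
      refine Finset.sum_eq_zero fun k _ => ?_
      rw [Subsingleton.elim k i, Subsingleton.elim j i]
      ring
    rw [this, map_zero]
  rw [← hf, hstab, finrank_top, hfin]

/-- Scalars lie in every stabilizer, so in index 1 some form `f` has exactly the scalars. As `𝔭` is
`𝔭ₛ` plus scalars, an element stabilizing the restriction of `f` to `𝔭ₛ` also stabilizes `f`; it is
a traceless scalar, hence zero. -/
theorem isFrobeniusLie_parabolicSL {a : List ℕ} (ha : 0 < a.sum)
    (h : lieIndex ℂ (parabolic a) = 1) : IsFrobeniusLie ℂ (parabolicSL a) := by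
  obtain ⟨f, hf⟩ := exists_finrank_coadjointStabilizer_eq ℂ (parabolic a)
  rw [h] at hf
  have hle : parabolicSL a ≤ parabolic a := inf_le_left
  have htr : ∀ x : parabolicSL a, x.1.trace = 0 := fun x =>
    LinearMap.mem_ker.1 ((LieSubalgebra.mem_inf _ _ _).1 x.2).2
  have hn : (a.sum : ℂ) ≠ 0 := by exact_mod_cast ha.ne'
  have hone : (1 : Matrix (Fin a.sum) (Fin a.sum) ℂ) ∈ parabolic a := Matrix.blockTriangular_one
  have hstab1 : (⟨1, hone⟩ : parabolic a) ∈ coadjointStabilizer f := by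
    intro y
    have : ⁅(⟨1, hone⟩ : parabolic a), y⁆ = 0 := by
      refine Subtype.ext ?_
      change 1 * y.1 - y.1 * 1 = 0
      rw [one_mul, mul_one, sub_self]
    rw [this, map_zero]
  have hne : (⟨⟨1, hone⟩, hstab1⟩ : coadjointStabilizer f) ≠ 0 := by
    intro h0
    have h1 : (1 : Matrix (Fin a.sum) (Fin a.sum) ℂ) = 0 :=
      congrArg (fun z : coadjointStabilizer f => z.1.1) h0
    have h2 := congrArg Matrix.trace h1
    rw [Matrix.trace_one, Fintype.card_fin, Matrix.trace_zero] at h2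
    exact hn h2
  have hbot : coadjointStabilizer
      (f ∘ₗ (LieSubalgebra.inclusion hle : parabolicSL a →ₗ[ℂ] parabolic a)) = ⊥ := by
    rw [eq_bot_iff]
    intro x hx
    have hx' : LieSubalgebra.inclusion hle x ∈ coadjointStabilizer f := by
      intro y
      -- split off the scalar part of `y`
      have hz : y.1 - (y.1.trace / a.sum) • (1 : Matrix (Fin a.sum) (Fin a.sum) ℂ) ∈
          parabolicSL a := by
        refine (LieSubalgebra.mem_inf _ _ _).2 ⟨sub_mem y.2 ((parabolic a).smul_mem _ hone), ?_⟩
        refine LinearMap.mem_ker.2 ?_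
        change Matrix.trace (y.1 - (y.1.trace / a.sum) • (1 : Matrix (Fin a.sum) (Fin a.sum) ℂ)) = 0
        rw [Matrix.trace_sub, Matrix.trace_smul, Matrix.trace_one, Fintype.card_fin, smul_eq_mul,
          div_mul_cancel₀ _ hn, sub_self]
      have h1 := hx ⟨_, hz⟩
      have h2 : LieSubalgebra.inclusion hle ⁅x, ⟨_, hz⟩⁆ = ⁅LieSubalgebra.inclusion hle x, y⁆ := by
        refine Subtype.ext ?_
        change x.1 * (y.1 - _) - (y.1 - _) * x.1 = x.1 * y.1 - y.1 * x.1
        rw [mul_sub, sub_mul, Matrix.mul_smul, Matrix.smul_mul, mul_one, one_mul,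
          sub_sub_sub_cancel_right]
      rw [← h2]
      exact h1
    obtain ⟨t, ht⟩ := (finrank_eq_one_iff_of_nonzero' _ hne).1 hf ⟨_, hx'⟩
    have ht' : t • (1 : Matrix (Fin a.sum) (Fin a.sum) ℂ) = x.1 :=
      congrArg (fun z : coadjointStabilizer f => z.1.1) ht
    have h3 := htr x
    rw [← ht', Matrix.trace_smul, Matrix.trace_one, Fintype.card_fin, smul_eq_mul] at h3
    have h4 : t = 0 := (mul_eq_zero.1 h3).resolve_right hn
    rw [h4, zero_smul] at ht'
    exact Subtype.ext ht'.symm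
  have := lieIndex_le_finrank (f ∘ₗ (LieSubalgebra.inclusion hle : parabolicSL a →ₗ[ℂ] parabolic a))
  rw [hbot, finrank_bot] at this
  exact Nat.le_zero.1 this

theorem lieIndex_parabolic_add_first (a b c : ℕ) :
    lieIndex ℂ (parabolic [a + (b + c), b, c]) = lieIndex ℂ (parabolic [a, b, c]) := by
  have := lieIndex_parabolic_add [] [b, c] a
  have e : ((([] : List ℕ).sum : ℤ) - ([b, c].sum : ℕ)).natAbs = b + c := by
    simp
    omega
  rw [e] at this
  exact this

theorem lieIndex_parabolic_add_last (a b c : ℕ) :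
    lieIndex ℂ (parabolic [a, b, c + (a + b)]) = lieIndex ℂ (parabolic [a, b, c]) := by
  have := lieIndex_parabolic_add [a, b] [] c
  have e : (([a, b].sum : ℤ) - ((([] : List ℕ).sum : ℕ) : ℤ)).natAbs = a + b := by
    simp
    omega
  rw [e] at this
  exact this

theorem lieIndex_parabolic_add_middle (a b c : ℕ) :
    lieIndex ℂ (parabolic [a, b + ((a : ℤ) - c).natAbs, c]) = lieIndex ℂ (parabolic [a, b, c]) := by
  have := lieIndex_parabolic_add [a] [c] b
  rw [show (([a].sum : ℤ) - ([c].sum : ℕ)).natAbs = ((a : ℤ) - c).natAbs by simp] at this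
  exact this

/-- Each reduction preserves both the index and `gcd (a + b, b + c)` while lowering `a + b + c`.
Zero blocks are allowed, so the descent ends at total size 1. -/
theorem lieIndex_parabolic_of_gcd_eq_one (a b c : ℕ) (h : Nat.gcd (a + b) (b + c) = 1) :
    lieIndex ℂ (parabolic [a, b, c]) = 1 := by
  obtain ⟨n, hn⟩ : ∃ n, n = a + b + c := ⟨_, rfl⟩
  induction n using Nat.strong_induction_on generalizing a b c with
  | _ n ih =>
    by_cases h1 : 0 < b + c ∧ b + c ≤ a
    · obtain ⟨k, rfl⟩ := Nat.exists_eq_add_of_le' h1.2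
      rw [lieIndex_parabolic_add_first]
      refine ih (k + b + c) (by omega) _ _ _ ?_ rfl
      rwa [show k + (b + c) + b = k + b + (b + c) by ring, Nat.gcd_add_self_left] at h
    by_cases h2 : 0 < a + b ∧ a + b ≤ c
    · obtain ⟨k, rfl⟩ := Nat.exists_eq_add_of_le' h2.2
      rw [lieIndex_parabolic_add_last]
      refine ih (a + b + k) (by omega) _ _ _ ?_ rfl
      rwa [show b + (k + (a + b)) = b + k + (a + b) by ring, Nat.gcd_add_self_right] at h
    by_cases h3 : a = c
    -- Here `a + b = 1`, and the failure of the first reduction rules out `a = 1`, leaving the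
    -- blocks `0, 1, 0`.
    · subst h3
      rw [add_comm b a, Nat.gcd_self] at h
      refine lieIndex_parabolic_of_sum_eq_one ?_
      simp
      omega
    by_cases h4 : b + c = 0
    · rw [h4, Nat.gcd_zero_right] at h
      refine lieIndex_parabolic_of_sum_eq_one ?_
      simp
      omega
    by_cases h5 : a + b = 0
    · rw [h5, Nat.gcd_zero_left] at h
      refine lieIndex_parabolic_of_sum_eq_one ?_
      simp
      omega
    -- Now `a < b + c` and `c < a + b`, so `b` exceeds `|a - c|`, which is positive because `a ≠ c`.
    obtain ⟨k, rfl⟩ : ∃ k, b = k + ((a : ℤ) - c).natAbs :=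
      ⟨b - ((a : ℤ) - c).natAbs, by omega⟩
    rw [lieIndex_parabolic_add_middle]
    refine ih (a + k + c) (by omega) _ _ _ ?_ rfl
    rcases le_total a c with hac | hac
    · obtain ⟨d, rfl⟩ := Nat.exists_eq_add_of_le hac
      rw [show ((a : ℤ) - (a + d : ℕ)).natAbs = d by omega] at h
      rw [show k + d + (a + d) = (a + (k + d)) + d by ring, Nat.gcd_self_add_right] at h
      rw [show k + (a + d) = (a + k) + d by ring, Nat.gcd_self_add_right]
      rwa [show a + (k + d) = a + k + d by ring, Nat.gcd_add_self_left] at h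
    · obtain ⟨d, rfl⟩ := Nat.exists_eq_add_of_le hac
      rw [show (((c + d : ℕ) : ℤ) - c).natAbs = d by omega] at h
      rw [show c + d + (k + d) = k + d + c + d by ring, Nat.gcd_self_add_left] at h
      rw [show c + d + k = k + c + d by ring, Nat.gcd_self_add_left]
      rwa [show k + d + c = k + c + d by ring, Nat.gcd_add_self_right] at h

end Frobenius

theorem mainTheorem9 (a b c α : ℕ) (ha : 0 < a) (hb : 0 < b) (hc : 0 < c) (hα : 0 < α) :
    (lieIndex ℂ (parabolic [α * (a + b + c), a, b, c]) = lieIndex ℂ (parabolic [a, b, c]) ∧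
      lieIndex ℂ (parabolic [a, α * ((a : ℤ) - b - c).natAbs, b, c]) =
        lieIndex ℂ (parabolic [a, b, c]) ∧
      lieIndex ℂ (parabolic [a, b, α * ((a : ℤ) + b - c).natAbs, c]) =
        lieIndex ℂ (parabolic [a, b, c])) ∧
    (Nat.gcd (a + b) (b + c) = 1 →
      IsFrobeniusLie ℂ (parabolicSL [a, b, c]) ∧
      IsFrobeniusLie ℂ (parabolicSL [α * (a + b + c), a, b, c]) ∧
      IsFrobeniusLie ℂ (parabolicSL [a, α * ((a : ℤ) - b - c).natAbs, b, c]) ∧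
      IsFrobeniusLie ℂ (parabolicSL [a, b, α * ((a : ℤ) + b - c).natAbs, c]) ∧
      IsFrobeniusLie ℂ (parabolicSL [a, b, c, α * (a + b + c)])) := by
  have h1 : lieIndex ℂ (parabolic [α * (a + b + c), a, b, c]) =
      lieIndex ℂ (parabolic [a, b, c]) := by
    have := lieIndex_parabolic_mul [] [a, b, c] α
    rw [show ((([] : List ℕ).sum : ℤ) - ([a, b, c].sum : ℕ)).natAbs = a + b + c by
      simp; omega] at this
    exact this
  have h2 : lieIndex ℂ (parabolic [a, α * ((a : ℤ) - b - c).natAbs, b, c]) =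
      lieIndex ℂ (parabolic [a, b, c]) := by
    have := lieIndex_parabolic_mul [a] [b, c] α
    rw [show (([a].sum : ℤ) - ([b, c].sum : ℕ)).natAbs = ((a : ℤ) - b - c).natAbs by
      simp; omega] at this
    exact this
  have h3 : lieIndex ℂ (parabolic [a, b, α * ((a : ℤ) + b - c).natAbs, c]) =
      lieIndex ℂ (parabolic [a, b, c]) := by
    have := lieIndex_parabolic_mul [a, b] [c] α
    rw [show (([a, b].sum : ℤ) - ([c].sum : ℕ)).natAbs = ((a : ℤ) + b - c).natAbs by
      simp] at this
    exact this
  have h4 : lieIndex ℂ (parabolic [a, b, c, α * (a + b + c)]) =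
      lieIndex ℂ (parabolic [a, b, c]) := by
    have := lieIndex_parabolic_mul [a, b, c] [] α
    rw [show (([a, b, c].sum : ℤ) - ((([] : List ℕ).sum : ℕ) : ℤ)).natAbs = a + b + c by
      simp; omega] at this
    exact this
  refine ⟨⟨h1, h2, h3⟩, fun h => ?_⟩
  have h0 := lieIndex_parabolic_of_gcd_eq_one a b c h
  refine ⟨isFrobeniusLie_parabolicSL ?_ h0, isFrobeniusLie_parabolicSL ?_ (h1.trans h0),
    isFrobeniusLie_parabolicSL ?_ (h2.trans h0), isFrobeniusLie_parabolicSL ?_ (h3.trans h0),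
    isFrobeniusLie_parabolicSL ?_ (h4.trans h0)⟩ <;>
  · simp only [List.sum_cons]
    omega
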